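/- **Conventions.** Let $dA(z)=d^2z/\pi$. For a weight $\omega:\mathbb{C}\to\mathbb{R}_{\ge 0}$ put $$\langle f,g\rangle_s:=\int_{\mathbb{C}}\big(f(z)\overline{g(z)}-g(z)\overline{f(z)}\big)(z-\overline z)\,\omega(z)\,dA(z).$$ Monic polynomials $(q_n)_{n\ge0}$ with $\deg q_n=n$ are called planar skew-orthogonal polynomials (SOPs) for $\omega$ with skew-norms $r_k>0$ if all these integrals converge for $f,g$ in the family and, for all $k,\ell\ge 0$, $$\langle q_{2k},q_{2\ell}\rangle_s=\langle q_{2k+1},q_{2\ell+1}\rangle_s=0,\qquad \langle q_{2k},q_{2\ell+1}\rangle_s=-\langle q_{2\ell+1},q_{2k}\rangle_s=r_k\,\delta_{k,\ell}.$$ Given such a family, its skew-kernel is $$\varkappa_N(z,w):=\sum_{k=0}^{N-1}\frac{q_{2k+1}(z)q_{2k}(w)-q_{2k}(z)q_{2k+1}(w)}{r_k},\qquad N\ge 0 .$$ For $a\in\mathbb{R}$ consider the weights $$\omega^{(\rm pre)}(z)=(1+|z-a|^2)e^{-2|z|^2},\qquad \omega^{(\rm over)}(z)=|z-a|^2\,\omega^{(\rm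 pre)}(z).$$ Let $f_k(x):=\sum_{j=0}^k (k+1-j)\frac{x^j}{j!}$, and let the explicit SOPs for $\omega^{(\rm pre)}$ be $$q^{(\rm pre)}_{2k}(z)=\sum_{j=0}^{2k}\alpha_{2k,j}z^j,\qquad q^{(\rm pre)}_{2k+1}(z)=\sum_{j=0}^{2k+1}\beta_{2k+1,j}z^j,\qquad r^{(\rm pre)}_k=\frac{(2k+2)!}{2^{2k+2}}\frac{f_{k+1}(a^2)}{f_k(a^2)},$$ with coefficients $$\alpha_{2k,2j}=\Big[\sum_{\ell=j}^{k}(\ell+1-j)\tfrac{(2k+3)!!}{(2\ell+3)!!}(2a^2)^{\ell-j}-\sum_{\ell=j}^{k}(\ell-j)\tfrac{(2k+1)!!}{(2\ell+1)!!}(2a^2)^{\ell-j}\Big]\frac{2^jf_j(a^2)}{2^kf_k(a^2)},$$ $$\alpha_{2k,2j+1}=2a\Big[\sum_{\ell=j}^{k-1}(\ell+1-j)\tfrac{(2k+3)!!}{(2\ell+5)!!}(2a^2)^{\ell-j}-\sum_{\ell=j}^{k-1}(\ell-j)\tfrac{(2k+1)!!}{(2\ell+3)!!}(2a^2)^{\ell-j}\Big]\frac{2^jf_j(a^2)}{2^kf_k(a^2)},$$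 $$\beta_{2k+1,2j}=a\Big[\tfrac{2j+1}{2k+3}(2a^2)^{k-j}+2\sum_{\ell=j}^{k}(\ell+1-j)\tfrac{(2k+1)!!}{(2\ell+3)!!}(2a^2)^{\ell-j}\Big]\frac{2^jf_j(a^2)}{2^kf_k(a^2)},$$ $$\beta_{2k+1,2j+1}=\Big[\tfrac{2j+3}{2k+3}(2a^2)^{k-j}+2\sum_{\ell=j}^{k}(\ell-j)\tfrac{(2k+1)!!}{(2\ell+3)!!}(2a^2)^{\ell-j}\Big]\frac{2^jf_j(a^2)}{2^kf_k(a^2)}$$ (with $0^0=1$). Let $\varkappa^{(\rm pre)}_N$ be the skew-kernel formed from $q_n^{(\rm pre)}$ and $r_k^{(\rm pre)}$. **Proposition.** Let $a\in\mathbb{R}$. Then $q^{(\rm pre)}_{2k}(a)\neq 0$ for all $k\ge 0$, and the following hold. * **(SOPs)** The formulas, for $z\ne a$, $$q_{2k}^{(\rm over)}(z)=\frac{r_k^{(\rm pre)}\,\varkappa^{(\rm pre)}_{k+1}(a,z)}{(a-z)\,q^{(\rm pre)}_{2k}(a)},\qquad q_{2k+1}^{(\rm over)}(z)=\frac{q^{(\rm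 pre)}_{2k+2}(a)\,q^{(\rm pre)}_{2k}(z)-q^{(\rm pre)}_{2k}(a)\,q^{(\rm pre)}_{2k+2}(z)}{(a-z)\,q^{(\rm pre)}_{2k}(a)}$$ define polynomials, and $(q_n^{(\rm over)})_{n\ge0}$ is a family of monic SOPs for $\omega^{(\rm over)}$ with skew-norms $$r_k^{(\rm over)}=r_k^{(\rm pre)}\,\frac{q^{(\rm pre)}_{2k+2}(a)}{q^{(\rm pre)}_{2k}(a)}>0 .$$ * **(Skew-kernel)** Let $\varkappa^{(\rm over)}_N$ be the skew-kernel formed from $q_n^{(\rm over)}$ and $r_k^{(\rm over)}$. For every $N\ge0$ and all $z,w\in\mathbb{C}\setminus\{a\}$, $$\varkappa_{N}^{(\rm over)}(z,w)=\frac{\varkappa_M^{(\rm pre)}(z,w)\,q^{(\rm pre)}_{2N}(a)-\varkappa_M^{(\rm pre)}(z,a)\,q^{(\rm pre)}_{2N}(w)+\varkappa_M^{(\rm pre)}(w,a)\,q^{(\rm pre)}_{2N}(z)}{(z-a)(w-a)\,q^{(\rm pre)}_{2N}(a)}$$ both for $M=N$ and for $M=N+1$. -/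

import Mathlib

open Polynomial MeasureTheory
open scoped ComplexConjugate Nat

noncomputable section

/-! ### Planar skew-orthogonal polynomials for a general weight -/

/-- The area measure `dA(z) = d²z / π` on the complex plane. -/
def areaMeasure : Measure ℂ := ENNReal.ofReal (Real.pi⁻¹) • (volume : Measure ℂ)

/-- The integrand `(f(z) conj(g(z)) - g(z) conj(f(z))) (z - conj z) ω(z)` of the skew product. -/
def skewIntegrand (ω : ℂ → ℝ) (f g : ℂ → ℂ) (z : ℂ) : ℂ :=
  (f z * conj (g z) - g z * conj (f z)) * (z - conj z) * (ω z : ℂ)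

/-- The skew product `⟨f, g⟩ₛ` with respect to the measure `ω(z) dA(z)`. -/
def skewProduct (ω : ℂ → ℝ) (f g : ℂ → ℂ) : ℂ :=
  ∫ z, skewIntegrand ω f g z ∂areaMeasure

/-- `q` is a family of (monic) planar skew-orthogonal polynomials for the weight `ω`, with positive
skew-norms `r`. All the integrals involved are required to converge. -/
structure IsPlanarSOP (ω : ℂ → ℝ) (q : ℕ → ℂ[X]) (r : ℕ → ℝ) : Prop where
  monic : ∀ n, (q n).Monic
  natDegree_eq : ∀ n, (q n).natDegree = n
  integrable : ∀ m n,
    Integrable (skewIntegrand ω (fun z => (q m).eval z) (fun z => (q n).eval z)) areaMeasure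
  even_even : ∀ k l,
    skewProduct ω (fun z => (q (2 * k)).eval z) (fun z => (q (2 * l)).eval z) = 0
  odd_odd : ∀ k l,
    skewProduct ω (fun z => (q (2 * k + 1)).eval z) (fun z => (q (2 * l + 1)).eval z) = 0
  even_odd : ∀ k l,
    skewProduct ω (fun z => (q (2 * k)).eval z) (fun z => (q (2 * l + 1)).eval z)
      = if k = l then (r k : ℂ) else 0
  odd_even : ∀ k l,
    skewProduct ω (fun z => (q (2 * l + 1)).eval z) (fun z => (q (2 * k)).eval z)
      = -(if k = l then (r k : ℂ) else 0)
  norm_pos : ∀ k, 0 < r k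

/-- The skew-kernel
`ϰ_N(z, w) = ∑_{k < N} (q_{2k+1}(z) q_{2k}(w) - q_{2k}(z) q_{2k+1}(w)) / r_k`. -/
def skewKernel (q : ℕ → ℂ[X]) (r : ℕ → ℝ) (N : ℕ) (z w : ℂ) : ℂ :=
  ∑ k ∈ Finset.range N,
    ((q (2 * k + 1)).eval z * (q (2 * k)).eval w - (q (2 * k)).eval z * (q (2 * k + 1)).eval w)
      / (r k : ℂ)

/-! ### The two weights -/

/-- The pre-overlap weight `(1 + |z - x|²) exp(-2|z|²)`. -/
def preWeight (x z : ℂ) : ℝ := (1 + ‖z - x‖ ^ 2) * Real.exp (-2 * ‖z‖ ^ 2)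

/-- The overlap weight `|z - conj x|² (1 + |z - x|²) exp(-2|z|²)`. -/
def overWeight (x z : ℂ) : ℝ :=
  ‖z - conj x‖ ^ 2 * (1 + ‖z - x‖ ^ 2) * Real.exp (-2 * ‖z‖ ^ 2)

/-! ### The explicit polynomials and norms of the pre-overlap weight, for real `a` -/

/-- `f_k(x) = ∑_{j=0}^k (k + 1 - j) x^j / j!`. -/
def fSum (k : ℕ) (x : ℝ) : ℝ :=
  ∑ j ∈ Finset.range (k + 1), ((k : ℝ) + 1 - j) * x ^ j / (j ! : ℝ)

/-- The common factor `2^j f_j(a²) / (2^k f_k(a²))` of the coefficients. -/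
def coeffRatio (a : ℝ) (k j : ℕ) : ℝ :=
  (2 ^ j * fSum j (a ^ 2)) / (2 ^ k * fSum k (a ^ 2))

/-- The coefficient of `z^{2j}` in `q_{2k}`. Here, as in the other coefficients, the quotient
`(2a²)^ℓ / (2a²)^j` is read as `(2a²)^{ℓ-j}`, so that `a = 0` is included. -/
def alphaEven (a : ℝ) (k j : ℕ) : ℝ :=
  (∑ l ∈ Finset.Icc j k,
      ((l : ℝ) + 1 - j) * (((2 * k + 3)‼ : ℝ) / ((2 * l + 3)‼ : ℝ)) * (2 * a ^ 2) ^ (l - j)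
    - ∑ l ∈ Finset.Icc j k,
      ((l : ℝ) - j) * (((2 * k + 1)‼ : ℝ) / ((2 * l + 1)‼ : ℝ)) * (2 * a ^ 2) ^ (l - j))
    * coeffRatio a k j

/-- The coefficient of `z^{2j+1}` in `q_{2k}`; the sums run over `j ≤ ℓ ≤ k - 1`. -/
def alphaOdd (a : ℝ) (k j : ℕ) : ℝ :=
  2 * a * (∑ l ∈ Finset.Ico j k,
      ((l : ℝ) + 1 - j) * (((2 * k + 3)‼ : ℝ) / ((2 * l + 5)‼ : ℝ)) * (2 * a ^ 2) ^ (l - j)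
    - ∑ l ∈ Finset.Ico j k,
      ((l : ℝ) - j) * (((2 * k + 1)‼ : ℝ) / ((2 * l + 3)‼ : ℝ)) * (2 * a ^ 2) ^ (l - j))
    * coeffRatio a k j

/-- The coefficient of `z^{2j}` in `q_{2k+1}`. -/
def betaEven (a : ℝ) (k j : ℕ) : ℝ :=
  a * ((2 * (j : ℝ) + 1) / (2 * (k : ℝ) + 3) * (2 * a ^ 2) ^ (k - j)
    + 2 * ∑ l ∈ Finset.Icc j k,
      ((l : ℝ) + 1 - j) * (((2 * k + 1)‼ : ℝ) / ((2 * l + 3)‼ : ℝ)) * (2 * a ^ 2) ^ (l - j))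
    * coeffRatio a k j

/-- The coefficient of `z^{2j+1}` in `q_{2k+1}`. -/
def betaOdd (a : ℝ) (k j : ℕ) : ℝ :=
  ((2 * (j : ℝ) + 3) / (2 * (k : ℝ) + 3) * (2 * a ^ 2) ^ (k - j)
    + 2 * ∑ l ∈ Finset.Icc j k,
      ((l : ℝ) - j) * (((2 * k + 1)‼ : ℝ) / ((2 * l + 3)‼ : ℝ)) * (2 * a ^ 2) ^ (l - j))
    * coeffRatio a k j

/-- The even polynomial `q_{2k}` of the pre-overlap weight (its coefficients are real). -/
def preEven (a : ℝ) (k : ℕ) : ℝ[X] :=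
  ∑ j ∈ Finset.range (k + 1), C (alphaEven a k j) * X ^ (2 * j)
    + ∑ j ∈ Finset.range k, C (alphaOdd a k j) * X ^ (2 * j + 1)

/-- The odd polynomial `q_{2k+1}` of the pre-overlap weight (its coefficients are real). -/
def preOdd (a : ℝ) (k : ℕ) : ℝ[X] :=
  ∑ j ∈ Finset.range (k + 1), C (betaEven a k j) * X ^ (2 * j)
    + ∑ j ∈ Finset.range (k + 1), C (betaOdd a k j) * X ^ (2 * j + 1)

/-- The family `q_n^{(pre)}` as real polynomials. -/
def qPreReal (a : ℝ) (n : ℕ) : ℝ[X] :=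
  if n % 2 = 0 then preEven a (n / 2) else preOdd a (n / 2)

/-- The family `q_n^{(pre)}`. -/
def qPre (a : ℝ) (n : ℕ) : ℂ[X] := (qPreReal a n).map Complex.ofRealHom

/-- The skew-norms `r_k^{(pre)} = (2k+2)! / 2^{2k+2} * f_{k+1}(a²) / f_k(a²)`. -/
def rPre (a : ℝ) (k : ℕ) : ℝ :=
  ((2 * k + 2)! : ℝ) / 2 ^ (2 * k + 2) * (fSum (k + 1) (a ^ 2) / fSum k (a ^ 2))

/-- The skew-kernel `ϰ_N^{(pre)}`. -/
def kernelPre (a : ℝ) (N : ℕ) (z w : ℂ) : ℂ := skewKernel (qPre a) (rPre a) N z w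

/-- The skew-norms `r_k^{(over)} = r_k^{(pre)} q_{2k+2}^{(pre)}(a) / q_{2k}^{(pre)}(a)`. -/
def rOver (a : ℝ) (k : ℕ) : ℝ :=
  rPre a k * ((qPreReal a (2 * k + 2)).eval a / (qPreReal a (2 * k)).eval a)

end

/-! Since a is real, |z - a|² = (z - a)(conj z - a), so the overlap skew product of f and g is the
pre-overlap skew product of (z - a)f and (z - a)g. The new family therefore consists of quotients by
z - a of combinations of the old polynomials that vanish at a (a Christoffel transform). All
coefficients are real, so real bilinear forms on ℝ[X] suffice.

The kernel section ϰ_N(a, ·) reproduces values at a: its pairing with q_m is q_m(a) for m < 2N and 0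
otherwise. By antisymmetry it vanishes at a, and two such sections pair to zero. Normalised, it
gives the even members. The odd members come from q_{2k+2} - (q_{2k+2}(a)/q_{2k}(a)) q_{2k}; the
reproducing property gives all remaining pairings (`IsSkewBasis.christoffel`). The kernel formula is
then an induction on N (`sum_christoffel_values`).

Two inputs concern the explicit polynomials. First, they are skew-orthogonal for the pre-overlap
weight (`isSkewBasis_qPreReal`): by Gaussian moments, pairing with z^m is a short linear expression
in neighbouring coefficients, and it vanishes by the three-term recurrence of f_k together with
recurrences of the bracketed double-factorial sums. Second, q_{2k}(a) > 0, because every term of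
this value is nonnegative (`eval_qPreReal_even_pos`). -/

/-! ### Gaussian moments -/

/-- `f` is integrable with respect to the area measure, with integral `v`. -/
def HasAreaIntegral (f : ℂ → ℂ) (v : ℂ) : Prop :=
  Integrable f areaMeasure ∧ ∫ z, f z ∂areaMeasure = v

namespace HasAreaIntegral

variable {f g : ℂ → ℂ} {u v : ℂ}

lemma add (hf : HasAreaIntegral f u) (hg : HasAreaIntegral g v) :
    HasAreaIntegral (fun z => f z + g z) (u + v) :=
  ⟨hf.1.add hg.1, by rw [integral_add hf.1 hg.1, hf.2, hg.2]⟩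

lemma sub (hf : HasAreaIntegral f u) (hg : HasAreaIntegral g v) :
    HasAreaIntegral (fun z => f z - g z) (u - v) :=
  ⟨hf.1.sub hg.1, by rw [integral_sub hf.1 hg.1, hf.2, hg.2]⟩

lemma const_mul (c : ℂ) (hf : HasAreaIntegral f u) :
    HasAreaIntegral (fun z => c * f z) (c * u) :=
  ⟨hf.1.const_mul c, by rw [integral_const_mul, hf.2]⟩

lemma congr (hf : HasAreaIntegral f u) (hfg : ∀ z, g z = f z) (huv : v = u) :
    HasAreaIntegral g v := by
  rw [huv, funext hfg]
  exact hf

end HasAreaIntegral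

/-- The integrand of the Gaussian moment of order `(m, n)`. -/
noncomputable def gaussMonomial (m n : ℕ) (z : ℂ) : ℂ :=
  z ^ m * conj z ^ n * (Real.exp (-2 * ‖z‖ ^ 2) : ℂ)

/-- The diagonal Gaussian moments. -/
noncomputable def gaussMoment (n : ℕ) : ℝ := (n ! : ℝ) / 2 ^ (n + 1)

lemma gaussMoment_succ (n : ℕ) : gaussMoment (n + 1) = (n + 1) / 2 * gaussMoment n := by
  unfold gaussMoment
  rw [Nat.factorial_succ, pow_succ (2 : ℝ) (n + 1)]
  push_cast
  field_simp

lemma integral_norm_pow_mul_gauss (n : ℕ) :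
    ∫ z : ℂ, ‖z‖ ^ n * Real.exp (-2 * ‖z‖ ^ 2)
      = Real.pi * 2 ^ (-((n : ℝ) + 2) / 2) * Real.Gamma (((n : ℝ) + 2) / 2) := by
  have h := Complex.integral_rpow_mul_exp_neg_mul_rpow (p := 2) (q := n) (b := 2) (by norm_num)
    (by have : (0 : ℝ) ≤ n := n.cast_nonneg
        linarith) (by norm_num)
  simp only [Real.rpow_natCast, Real.rpow_two] at h
  rw [h]
  ring

lemma integrable_norm_pow_mul_gauss (n : ℕ) :
    Integrable (fun z : ℂ => ‖z‖ ^ n * Real.exp (-2 * ‖z‖ ^ 2)) := by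
  by_contra h
  have h1 := integral_norm_pow_mul_gauss n
  -- A non-integrable function has integral 0 by convention, which contradicts the positive closed
  -- form.
  rw [integral_undef h] at h1
  have : 0 < Real.Gamma (((n : ℝ) + 2) / 2) := Real.Gamma_pos_of_pos (by positivity)
  have : 0 < Real.pi * 2 ^ (-((n : ℝ) + 2) / 2) * Real.Gamma (((n : ℝ) + 2) / 2) := by positivity
  linarith

lemma norm_gaussMonomial (m n : ℕ) (z : ℂ) :
    ‖gaussMonomial m n z‖ = ‖z‖ ^ (m + n) * Real.exp (-2 * ‖z‖ ^ 2) := by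
  simp only [gaussMonomial, norm_mul, norm_pow, RCLike.norm_conj, Complex.norm_real,
    Real.norm_eq_abs, abs_of_pos (Real.exp_pos _), pow_add]

lemma integrable_gaussMonomial (m n : ℕ) : Integrable (gaussMonomial m n) := by
  refine (integrable_norm_pow_mul_gauss (m + n)).mono' ?_ ?_
  · unfold gaussMonomial
    have : Continuous fun z : ℂ => z ^ m * conj z ^ n * (Real.exp (-2 * ‖z‖ ^ 2) : ℂ) := by
      have := Complex.continuous_conj
      fun_prop
    exact this.aestronglyMeasurable
  · exact Filter.Eventually.of_forall fun z => (norm_gaussMonomial m n z).le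

lemma integral_gaussMonomial_of_ne {m n : ℕ} (h : m ≠ n) : ∫ z, gaussMonomial m n z = 0 := by
  have hmn : ((m : ℂ) - n) ≠ 0 := sub_ne_zero.2 (by exact_mod_cast h)
  -- Rotation by π/(m - n) multiplies z^m conj(z)^n by exp(iπ) = -1 and preserves the measure, so
  -- the integral equals its own negative.
  set u : Circle := Circle.exp (Real.pi / ((m : ℝ) - n)) with hu
  have hrot : ∀ z, gaussMonomial m n (rotation u z) = -gaussMonomial m n z := by
    intro z
    have hc : ((u : ℂ)) ^ m * conj (u : ℂ) ^ n = -1 := by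
      rw [← Circle.coe_inv_eq_conj, hu, ← Circle.exp_neg, Circle.coe_exp, Circle.coe_exp,
        ← Complex.exp_nat_mul, ← Complex.exp_nat_mul, ← Complex.exp_add, ← Complex.exp_pi_mul_I]
      congr 1
      push_cast
      field_simp
      ring
    simp only [gaussMonomial, rotation_apply, map_mul, mul_pow, norm_mul, Circle.norm_coe, one_mul]
    linear_combination (z ^ m * conj z ^ n * (Real.exp (-2 * ‖z‖ ^ 2) : ℂ)) * hc
  have hinv := (LinearIsometryEquiv.measurePreserving (rotation u)).integral_comp
    (rotation u).toHomeomorph.measurableEmbedding (gaussMonomial m n)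
  simp only [hrot, integral_neg] at hinv
  have h2 : (2 : ℂ) * ∫ z, gaussMonomial m n z = 0 := by linear_combination -hinv
  simpa using h2

lemma integral_gaussMonomial_self (n : ℕ) :
    ∫ z, gaussMonomial n n z = ((Real.pi * gaussMoment n : ℝ) : ℂ) := by
  have h1 : ∀ z, gaussMonomial n n z
      = ((‖z‖ ^ (2 * n) * Real.exp (-2 * ‖z‖ ^ 2) : ℝ) : ℂ) := by
    intro z
    simp only [gaussMonomial]
    rw [← mul_pow, Complex.mul_conj, Complex.normSq_eq_norm_sq, pow_mul]
    push_cast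
    rfl
  simp only [h1]
  rw [integral_complex_ofReal, integral_norm_pow_mul_gauss]
  congr 1
  have h2 : (((2 * n : ℕ) : ℝ) + 2) / 2 = n + 1 := by push_cast; ring
  have h3 : -(((2 * n : ℕ) : ℝ) + 2) / 2 = -((n + 1 : ℕ) : ℝ) := by push_cast; ring
  rw [h2, h3, Real.Gamma_nat_eq_factorial, Real.rpow_neg (by norm_num), Real.rpow_natCast]
  unfold gaussMoment
  field_simp

lemma hasAreaIntegral_gaussMonomial (m n : ℕ) :
    HasAreaIntegral (gaussMonomial m n) (if m = n then (gaussMoment m : ℂ) else 0) := by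
  refine ⟨(integrable_gaussMonomial m n).smul_measure ENNReal.ofReal_ne_top, ?_⟩
  rw [areaMeasure, integral_smul_measure, ENNReal.toReal_ofReal (by positivity)]
  split_ifs with h
  · subst h
    rw [integral_gaussMonomial_self, Complex.real_smul, ← Complex.ofReal_mul]
    congr 1
    field_simp
  · rw [integral_gaussMonomial_of_ne h, smul_zero]

/-! ### The skew product as a bilinear form on real polynomials -/

/-- The skew product of two real polynomials, as a function of the polynomials. -/
noncomputable def realSkew (ω : ℂ → ℝ) (f g : ℝ[X]) : ℂ :=
  skewProduct ω (fun z => aeval z f) (fun z => aeval z g)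

/-- All the integrals defining the skew product of real polynomials converge. -/
def SkewIntegrable (ω : ℂ → ℝ) : Prop :=
  ∀ f g : ℝ[X], Integrable (skewIntegrand ω (fun z => aeval z f) (fun z => aeval z g)) areaMeasure

/-- The skew product as an `ℝ`-bilinear form on real polynomials. -/
noncomputable def skewForm {ω : ℂ → ℝ} (h : SkewIntegrable ω) : ℝ[X] →ₗ[ℝ] ℝ[X] →ₗ[ℝ] ℂ :=
  LinearMap.mk₂ ℝ (realSkew ω)
    (fun f₁ f₂ g => by
      unfold realSkew skewProduct
      rw [← integral_add (h _ _) (h _ _)]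
      congr 1; ext z
      simp only [skewIntegrand, map_add]; ring)
    (fun c f g => by
      unfold realSkew skewProduct
      rw [← integral_smul]
      congr 1; ext z
      simp only [skewIntegrand, map_smul, Complex.real_smul, map_mul, Complex.conj_ofReal]; ring)
    (fun f g₁ g₂ => by
      unfold realSkew skewProduct
      rw [← integral_add (h _ _) (h _ _)]
      congr 1; ext z
      simp only [skewIntegrand, map_add]; ring)
    (fun c f g => by
      unfold realSkew skewProduct
      rw [← integral_smul]
      congr 1; ext z
      simp only [skewIntegrand, map_smul, Complex.real_smul, map_mul, Complex.conj_ofReal]; ring)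

lemma skewForm_apply {ω : ℂ → ℝ} (h : SkewIntegrable ω) (f g : ℝ[X]) :
    skewForm h f g = realSkew ω f g := rfl

lemma skewForm_isAlt {ω : ℂ → ℝ} (h : SkewIntegrable ω) : (skewForm h).IsAlt := by
  intro f
  simp [skewForm_apply, realSkew, skewProduct, skewIntegrand]

/-- Integrability of the skew products follows from that on monomials. -/
lemma skewIntegrable_of_monomials {ω : ℂ → ℝ}
    (h : ∀ m n : ℕ, Integrable (skewIntegrand ω (fun z => z ^ m) (fun z => z ^ n)) areaMeasure) :
    SkewIntegrable ω := by
  intro f g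
  induction f using Polynomial.induction_on' with
  | add f₁ f₂ h₁ h₂ =>
    refine (h₁.add h₂).congr (Filter.Eventually.of_forall fun z => ?_)
    simp only [skewIntegrand, map_add, Pi.add_apply]; ring
  | monomial m c =>
    induction g using Polynomial.induction_on' with
    | add g₁ g₂ h₁ h₂ =>
      refine (h₁.add h₂).congr (Filter.Eventually.of_forall fun z => ?_)
      simp only [skewIntegrand, map_add, Pi.add_apply]; ring
    | monomial n d =>
      refine ((h m n).const_mul ((c : ℂ) * d)).congr (Filter.Eventually.of_forall fun z => ?_)
      simp only [skewIntegrand, aeval_monomial, Complex.coe_algebraMap, map_mul, map_pow,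
        Complex.conj_ofReal]
      ring

/-! ### The pre-overlap weight on monomials -/

/-- The integral of `z^m conj(z)^n (z - conj z)` against the pre-overlap weight. -/
noncomputable def preHalfMoment (a : ℝ) (m n : ℕ) : ℝ :=
  (1 + a ^ 2) * ((if m + 1 = n then gaussMoment (m + 1) else 0)
      - (if m = n + 1 then gaussMoment m else 0))
    + ((if m + 2 = n + 1 then gaussMoment (m + 2) else 0)
      - (if m + 1 = n + 2 then gaussMoment (m + 1) else 0))
    - a * ((if m + 2 = n then gaussMoment (m + 2) else 0)
      - (if m = n + 2 then gaussMoment m else 0))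

lemma preWeight_eq (a : ℝ) (z : ℂ) :
    (preWeight a z : ℂ)
      = (1 + (z - a) * (conj z - a)) * (Real.exp (-2 * ‖z‖ ^ 2) : ℂ) := by
  have h : ((‖z - a‖ ^ 2 : ℝ) : ℂ) = (z - a) * (conj z - a) := by
    rw [← Complex.normSq_eq_norm_sq, ← Complex.mul_conj, map_sub, Complex.conj_ofReal]
  rw [preWeight, Complex.ofReal_mul, Complex.ofReal_add, h, Complex.ofReal_one]

lemma hasAreaIntegral_preHalf (a : ℝ) (m n : ℕ) :
    HasAreaIntegral (fun z => z ^ m * conj z ^ n * (z - conj z) * (preWeight a z : ℂ))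
      (preHalfMoment a m n : ℂ) := by
  have H := hasAreaIntegral_gaussMonomial
  refine (((((H (m + 1) n).sub (H m (n + 1))).const_mul (1 + (a : ℂ) ^ 2)).add
    ((H (m + 2) (n + 1)).sub (H (m + 1) (n + 2)))).sub
    (((H (m + 2) n).sub (H m (n + 2))).const_mul (a : ℂ))).congr (fun z => ?_) ?_
  · rw [preWeight_eq]
    simp only [gaussMonomial]
    ring
  · unfold preHalfMoment
    push_cast [apply_ite Complex.ofReal]
    rfl

lemma hasAreaIntegral_pre_monomials (a : ℝ) (m n : ℕ) :
    HasAreaIntegral (skewIntegrand (preWeight a) (fun z => z ^ m) (fun z => z ^ n))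
      ((preHalfMoment a m n - preHalfMoment a n m : ℝ) : ℂ) := by
  refine ((hasAreaIntegral_preHalf a m n).sub (hasAreaIntegral_preHalf a n m)).congr
    (fun z => ?_) (by push_cast; rfl)
  simp only [skewIntegrand, map_pow]
  ring

lemma skewIntegrable_preWeight (a : ℝ) : SkewIntegrable (preWeight a) :=
  skewIntegrable_of_monomials fun m n => (hasAreaIntegral_pre_monomials a m n).1

/-- The skew form of the pre-overlap weight. -/
noncomputable def preForm (a : ℝ) : ℝ[X] →ₗ[ℝ] ℝ[X] →ₗ[ℝ] ℂ :=
  skewForm (skewIntegrable_preWeight a)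

lemma preForm_X_pow (a : ℝ) (m n : ℕ) :
    preForm a (X ^ m) (X ^ n) = ((preHalfMoment a m n - preHalfMoment a n m : ℝ) : ℂ) := by
  rw [← (hasAreaIntegral_pre_monomials a m n).2]
  simp [preForm, skewForm_apply, realSkew, skewProduct]

/-- The skew product of `q` with `X^m` is a five-term expression in the coefficients of `q`,
written here with those of `X^2 q` so that small `m` are included. -/
lemma preForm_right_X_pow (a : ℝ) (q : ℝ[X]) (m : ℕ) :
    preForm a q (X ^ m) = ((2 * gaussMoment m *
      ((a ^ 2 + (m + 3) / 2) * (X ^ 2 * q).coeff (m + 1)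
        - (m + 1) / 2 * (a ^ 2 + (m + 4) / 2) * (X ^ 2 * q).coeff (m + 3)
        - a * (X ^ 2 * q).coeff m
        + a * ((m + 1) * (m + 2) / 4) * (X ^ 2 * q).coeff (m + 4)) : ℝ) : ℂ) := by
  induction q using Polynomial.induction_on' with
  | add f g hf hg =>
    simp only [map_add, LinearMap.add_apply, hf, hg, mul_add (X ^ 2 : ℝ[X]), coeff_add]
    push_cast
    ring
  | monomial n c =>
    rw [← C_mul_X_pow_eq_monomial, ← smul_eq_C_mul, map_smul, LinearMap.smul_apply, preForm_X_pow,
      mul_smul_comm, ← pow_add]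
    simp only [coeff_smul, coeff_X_pow, smul_eq_mul, Complex.real_smul, ← Complex.ofReal_mul]
    congr 1
    unfold preHalfMoment
    have hs := gaussMoment_succ
    -- The pairing can be nonzero only for n = m ± 1 and n = m ± 2; these cases are checked one by
    -- one.
    by_cases h1 : n = m + 1
    · subst h1
      simp (disch := omega) only [if_pos, if_neg, hs]
      push_cast
      ring
    by_cases h2 : n = m + 2
    · subst h2
      simp (disch := omega) only [if_pos, if_neg, hs]
      push_cast
      ring
    by_cases h3 : m = n + 1
    · subst h3
      simp (disch := omega) only [if_pos, if_neg, hs]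
      push_cast
      ring
    by_cases h4 : m = n + 2
    · subst h4
      simp (disch := omega) only [if_pos, if_neg, hs]
      push_cast
      ring
    simp (disch := omega) only [if_neg]
    ring

/-! ### The sums `f_k` -/

/-- The partial sums of the exponential series. -/
noncomputable def expSum (k : ℕ) (x : ℝ) : ℝ :=
  ∑ j ∈ Finset.range (k + 1), x ^ j / (j ! : ℝ)

lemma expSum_succ (k : ℕ) (x : ℝ) :
    expSum (k + 1) x = expSum k x + x ^ (k + 1) / ((k + 1)! : ℝ) := by
  unfold expSum
  rw [Finset.sum_range_succ]

lemma fSum_zero (x : ℝ) : fSum 0 x = 1 := by simp [fSum]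

lemma fSum_succ (k : ℕ) (x : ℝ) : fSum (k + 1) x = fSum k x + expSum (k + 1) x := by
  unfold fSum expSum
  rw [Finset.sum_range_succ, Finset.sum_range_succ _ (k + 1), ← add_assoc,
    ← Finset.sum_add_distrib]
  congr 1
  · refine Finset.sum_congr rfl fun j _ => ?_
    push_cast
    ring
  · push_cast
    ring

/-- From j x^j / j! = x · x^{j-1} / (j-1)!, f_k is k + 1 times the k-th exponential sum minus x
times the previous one. Consecutive f_k are thus expressed through a single exponential sum, which
reduces `fSum_recurrence` to algebra. -/
lemma fSum_eq_expSum (k : ℕ) (x : ℝ) :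
    fSum k x = (k + 1 - x) * expSum k x + x ^ (k + 1) / (k ! : ℝ) := by
  induction k with
  | zero => simp [fSum, expSum]
  | succ k ih =>
    have hk : ((k ! : ℕ) : ℝ) ≠ 0 := by positivity
    rw [fSum_succ, ih, expSum_succ, Nat.factorial_succ]
    push_cast
    field_simp
    ring

lemma fSum_recurrence (k : ℕ) (x : ℝ) :
    ((k : ℝ) + 2) * fSum (k + 2) x = (k + 3 + x) * fSum (k + 1) x - x * fSum k x := by
  have hk : ((k ! : ℕ) : ℝ) ≠ 0 := by positivity
  simp only [fSum_eq_expSum, expSum_succ, Nat.factorial_succ]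
  push_cast
  field_simp
  ring

lemma fSum_one (x : ℝ) : fSum 1 x = 2 + x := by
  simp [fSum, Finset.sum_range_succ]
  norm_num

lemma fSum_pos (k : ℕ) {x : ℝ} (hx : 0 ≤ x) : 0 < fSum k x := by
  induction k with
  | zero => simp [fSum_zero]
  | succ k ih =>
    rw [fSum_succ]
    have : 0 ≤ expSum (k + 1) x := Finset.sum_nonneg fun j _ => by positivity
    linarith

lemma coeffRatio_self (a : ℝ) (k : ℕ) : coeffRatio a k k = 1 := by
  have := fSum_pos k (sq_nonneg a)
  exact div_self (by positivity)

lemma coeffRatio_pos (a : ℝ) (k j : ℕ) : 0 < coeffRatio a k j := by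
  have := fSum_pos k (sq_nonneg a)
  have := fSum_pos j (sq_nonneg a)
  unfold coeffRatio
  positivity

lemma coeffRatio_recurrence (a : ℝ) (k j : ℕ) :
    ((j : ℝ) + 2) * coeffRatio a k (j + 2)
      = 2 * (j + 3 + a ^ 2) * coeffRatio a k (j + 1) - 4 * a ^ 2 * coeffRatio a k j := by
  have := fSum_pos k (sq_nonneg a)
  have h := fSum_recurrence j (a ^ 2)
  unfold coeffRatio
  field_simp
  linear_combination (4 * 2 ^ j) * h

/-- This is `coeffRatio_recurrence` at j = -1 with vanishing last term; it serves the lowest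
monomials. -/
lemma coeffRatio_one (a : ℝ) (k : ℕ) :
    coeffRatio a k 1 = 2 * (2 + a ^ 2) * coeffRatio a k 0 := by
  have := fSum_pos k (sq_nonneg a)
  unfold coeffRatio
  rw [fSum_one, fSum_zero]
  field_simp

/-! ### Orthogonality to monomials from recurrences of the coefficients -/

lemma coeff_X_sq_mul (q : ℝ[X]) (n : ℕ) : (X ^ 2 * q).coeff (n + 2) = q.coeff n :=
  coeff_X_pow_mul q 2 n

lemma coeff_X_sq_mul_of_lt (q : ℝ[X]) {n : ℕ} (hn : n < 2) : (X ^ 2 * q).coeff n = 0 := by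
  rw [coeff_X_pow_mul', if_neg (by omega)]

section Recurrence

variable {a : ℝ} {q : ℝ[X]} {k : ℕ} {G H : ℕ → ℝ}

/-- For z^{2i} with i > 0 only G_{i-1}, G_{i+1}, H_{i-1}, H_i enter. The two relations express all
of them through G_i and G_{i+1}, and what remains is a multiple of the recurrence of `coeffRatio`.
The odd case below works the same way. -/
lemma preForm_X_pow_even_eq_zero {i : ℕ}
    (hG : ∀ j ≤ i + 1, q.coeff (2 * j) = G j * coeffRatio a k j)
    (hH : ∀ j ≤ i, q.coeff (2 * j + 1) = H j * coeffRatio a k j)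
    (h : ∀ j ≤ i, H j = 2 * a * G (j + 1))
    (hrec : ∀ j < i, G j = (2 * a ^ 2 + 2 * j + 5) * G (j + 1) - (2 * j + 3) * a * H (j + 1)) :
    preForm a q (X ^ (2 * i)) = 0 := by
  rw [preForm_right_X_pow]
  norm_cast
  apply mul_eq_zero_of_right
  cases i with
  | zero =>
    have e1 : (X ^ 2 * q).coeff (2 * 0 + 3) = H 0 * coeffRatio a k 0 := by
      rw [← hH 0 le_rfl]; exact coeff_X_sq_mul q 1
    have e2 : (X ^ 2 * q).coeff (2 * 0 + 4) = G 1 * coeffRatio a k 1 := by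
      rw [← hG 1 le_rfl]; exact coeff_X_sq_mul q 2
    rw [e1, e2, coeff_X_sq_mul_of_lt q (by norm_num), coeff_X_sq_mul_of_lt q (by norm_num),
      h 0 le_rfl, coeffRatio_one]
    push_cast
    ring
  | succ i =>
    have e0 : (X ^ 2 * q).coeff (2 * (i + 1)) = G i * coeffRatio a k i := by
      rw [← hG i (by omega)]; exact coeff_X_sq_mul q (2 * i)
    have e1 : (X ^ 2 * q).coeff (2 * (i + 1) + 1) = H i * coeffRatio a k i := by
      rw [← hH i (by omega)]; exact coeff_X_sq_mul q (2 * i + 1)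
    have e3 : (X ^ 2 * q).coeff (2 * (i + 1) + 3) = H (i + 1) * coeffRatio a k (i + 1) := by
      rw [← hH (i + 1) le_rfl]; exact coeff_X_sq_mul q (2 * (i + 1) + 1)
    have e4 : (X ^ 2 * q).coeff (2 * (i + 1) + 4) = G (i + 2) * coeffRatio a k (i + 2) := by
      rw [← hG (i + 2) le_rfl]; exact coeff_X_sq_mul q (2 * (i + 2))
    have hr := coeffRatio_recurrence a k i
    have h1 := h (i + 1) le_rfl
    have h0 := h i (by omega)
    have hg := hrec i (by omega)
    rw [e0, e1, e3, e4, h0, hg, h1]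
    push_cast
    linear_combination (a * (i + 3 / 2) * G (i + 2)) * hr

lemma preForm_X_pow_odd_eq_zero {i : ℕ}
    (hG : ∀ j ≤ i + 1, q.coeff (2 * j) = G j * coeffRatio a k j)
    (hH : ∀ j ≤ i + 1, q.coeff (2 * j + 1) = H j * coeffRatio a k j)
    (h : ∀ j < i, H j = 2 * a * G (j + 1))
    (hrec : G i = (2 * a ^ 2 + 2 * i + 5) * G (i + 1) - (2 * i + 3) * a * H (i + 1)) :
    preForm a q (X ^ (2 * i + 1)) = 0 := by
  rw [preForm_right_X_pow]
  norm_cast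
  apply mul_eq_zero_of_right
  have e1 : (X ^ 2 * q).coeff (2 * i + 1 + 1) = G i * coeffRatio a k i := by
    rw [← hG i (by omega)]; exact coeff_X_sq_mul q (2 * i)
  have e3 : (X ^ 2 * q).coeff (2 * i + 1 + 3) = G (i + 1) * coeffRatio a k (i + 1) := by
    rw [← hG (i + 1) (by omega)]; exact coeff_X_sq_mul q (2 * (i + 1))
  have e4 : (X ^ 2 * q).coeff (2 * i + 1 + 4) = H (i + 1) * coeffRatio a k (i + 1) := by
    rw [← hH (i + 1) le_rfl]; exact coeff_X_sq_mul q (2 * (i + 1) + 1)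
  cases i with
  | zero =>
    rw [e1, e3, e4, hrec, coeff_X_sq_mul_of_lt q (by norm_num), coeffRatio_one]
    push_cast
    ring
  | succ i =>
    have e0 : (X ^ 2 * q).coeff (2 * (i + 1) + 1) = H i * coeffRatio a k i := by
      rw [← hH i (by omega)]; exact coeff_X_sq_mul q (2 * i + 1)
    have hr := coeffRatio_recurrence a k i
    have h0 := h i (by omega)
    rw [e0, e1, e3, e4, h0]
    push_cast at hrec ⊢
    linear_combination ((i + 2) / 2 * coeffRatio a k (i + 2)) * hrec - (G (i + 1) / 2) * hr

end Recurrence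

/-! ### The sums in the coefficients -/

/-- The quotients `(2k+1)!! / (2l+3)!!`. -/
noncomputable def dblRatio (k l : ℕ) : ℝ := ((2 * k + 1)‼ : ℝ) / ((2 * l + 3)‼ : ℝ)

lemma doubleFactorial_ne_zero (n : ℕ) : ((n‼ : ℕ) : ℝ) ≠ 0 := by
  exact_mod_cast (Nat.doubleFactorial_pos n).ne'

lemma doubleFactorial_odd_succ (n : ℕ) :
    (((2 * n + 3)‼ : ℕ) : ℝ) = (2 * n + 3) * ((2 * n + 1)‼ : ℕ) := by
  rw [show 2 * n + 3 = (2 * n + 1) + 2 by ring, Nat.doubleFactorial_add_two]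
  push_cast
  ring

lemma dblRatio_succ (k l : ℕ) : dblRatio k l = (2 * l + 5) * dblRatio k (l + 1) := by
  have h := doubleFactorial_odd_succ (l + 1)
  have h1 := doubleFactorial_ne_zero (2 * l + 3)
  unfold dblRatio
  rw [h, show 2 * (l + 1) + 1 = 2 * l + 3 by ring]
  have : (2 * (l : ℝ) + 5) ≠ 0 := by positivity
  push_cast
  rw [show (2 * ((l : ℝ) + 1) + 3) = 2 * l + 5 by ring]
  field_simp

lemma dblRatio_self (k : ℕ) : dblRatio k k = 1 / (2 * k + 3) := by
  have h := doubleFactorial_odd_succ k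
  have h1 := doubleFactorial_ne_zero (2 * k + 1)
  unfold dblRatio
  rw [h]
  field_simp

/-- The sum `∑_{l=j}^k (2k+1)!!/(2l+3)!! y^{l-j}`. -/
noncomputable def dblSum (y : ℝ) (k j : ℕ) : ℝ :=
  ∑ l ∈ Finset.Ico j (k + 1), dblRatio k l * y ^ (l - j)

/-- The sum `∑_{l=j}^k (l-j) (2k+1)!!/(2l+3)!! y^{l-j}`. -/
noncomputable def dblSumWeighted (y : ℝ) (k j : ℕ) : ℝ :=
  ∑ l ∈ Finset.Ico j (k + 1), ((l : ℝ) - j) * dblRatio k l * y ^ (l - j)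

lemma pow_sub_eq_mul_pow_sub_succ (y : ℝ) {j l : ℕ} (h : j + 1 ≤ l) :
    y ^ (l - j) = y * y ^ (l - (j + 1)) := by
  rw [← pow_succ']
  congr 1
  omega

lemma dblSum_succ (y : ℝ) {k j : ℕ} (h : j ≤ k) :
    dblSum y k j = dblRatio k j + y * dblSum y k (j + 1) := by
  unfold dblSum
  rw [Finset.sum_eq_sum_Ico_succ_bot (by omega), Finset.mul_sum]
  congr 1
  · simp
  · refine Finset.sum_congr rfl fun l hl => ?_
    rw [pow_sub_eq_mul_pow_sub_succ y (Finset.mem_Ico.1 hl).1]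
    ring

lemma dblSumWeighted_succ (y : ℝ) {k j : ℕ} (h : j ≤ k) :
    dblSumWeighted y k j = y * (dblSum y k (j + 1) + dblSumWeighted y k (j + 1)) := by
  unfold dblSum dblSumWeighted
  rw [Finset.sum_eq_sum_Ico_succ_bot (by omega), ← Finset.sum_add_distrib, Finset.mul_sum,
    sub_self, zero_mul, zero_mul, zero_add]
  refine Finset.sum_congr rfl fun l hl => ?_
  rw [pow_sub_eq_mul_pow_sub_succ y (Finset.mem_Ico.1 hl).1]
  push_cast
  ring

lemma dblSum_self_succ (y : ℝ) (k : ℕ) : dblSum y k (k + 1) = 0 := by simp [dblSum]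

lemma dblSumWeighted_self_succ (y : ℝ) (k : ℕ) : dblSumWeighted y k (k + 1) = 0 := by
  simp [dblSumWeighted]

/-- The left side weights the l-th term by 2(l - j) + 2j + 3 = 2l + 3, and (2l + 3) `dblRatio k l` =
`dblRatio k (l - 1)` for l ≥ 1. Shifting l gives y times the same sum, up to the first term and the
missing top term. -/
lemma dblSum_relation (y : ℝ) {k j : ℕ} (h : j ≤ k + 1) :
    2 * dblSumWeighted y k j + (2 * j + 3) * dblSum y k j
      = (2 * j + 3) * dblRatio k j + y * dblSum y k j - y ^ (k + 1 - j) / (2 * k + 3) := by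
  induction h using Nat.decreasingInduction with
  | self =>
    have h1 := dblRatio_succ k k
    rw [dblRatio_self] at h1
    rw [dblSum_self_succ, dblSumWeighted_self_succ]
    push_cast
    simp only [Nat.sub_self, pow_zero]
    linear_combination h1
  | of_succ j hj ih =>
    rw [dblSum_succ y (by omega), dblSumWeighted_succ y (by omega),
      pow_sub_eq_mul_pow_sub_succ y hj]
    have h1 := dblRatio_succ k j
    push_cast at ih ⊢
    linear_combination y * ih - y * h1

/-- The bracket in the coefficient of `z^{2j}` of `q_{2k}`. -/
noncomputable def alphaBracket (y : ℝ) (k j : ℕ) : ℝ :=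
  ∑ l ∈ Finset.Icc j k,
      ((l : ℝ) + 1 - j) * (((2 * k + 3)‼ : ℝ) / ((2 * l + 3)‼ : ℝ)) * y ^ (l - j)
    - ∑ l ∈ Finset.Icc j k,
      ((l : ℝ) - j) * (((2 * k + 1)‼ : ℝ) / ((2 * l + 1)‼ : ℝ)) * y ^ (l - j)

lemma alphaEven_eq (a : ℝ) (k j : ℕ) :
    alphaEven a k j = alphaBracket (2 * a ^ 2) k j * coeffRatio a k j := rfl

/-- Shifting l by one identifies the odd bracket at j with the even one at j + 1: this is the
relation H_j = 2a G_{j+1}. -/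
lemma alphaOdd_eq (a : ℝ) (k j : ℕ) :
    alphaOdd a k j = 2 * a * alphaBracket (2 * a ^ 2) k (j + 1) * coeffRatio a k j := by
  unfold alphaOdd alphaBracket
  rw [← Finset.Ico_add_one_right_eq_Icc, ← Finset.sum_Ico_add', ← Finset.sum_Ico_add']
  congr 3
  · refine Finset.sum_congr rfl fun l _ => ?_
    rw [Nat.add_sub_add_right, show 2 * (l + 1) + 3 = 2 * l + 5 by ring]
    push_cast
    ring
  · refine Finset.sum_congr rfl fun l _ => ?_
    rw [Nat.add_sub_add_right, show 2 * (l + 1) + 1 = 2 * l + 3 by ring]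
    push_cast
    ring

/-- This is the second sum of `alphaBracket`, as (2k+1)!!/(2l+1)!! = (2l + 3) `dblRatio k l`.
Lowering l by one turns the weight l - j into l + 1 - j; the subtracted power is the missing top
term. -/
lemma sum_shifted_dblRatio (y : ℝ) {k j : ℕ} (h : j ≤ k + 1) :
    ∑ l ∈ Finset.Ico j (k + 1), ((l : ℝ) - j) * ((2 * l + 3) * dblRatio k l) * y ^ (l - j)
      = y * (dblSum y k j + dblSumWeighted y k j)
        - (k + 1 - j) * y ^ (k + 1 - j) / (2 * k + 3) := by
  induction h using Nat.decreasingInduction with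
  | self => simp [dblSum_self_succ, dblSumWeighted_self_succ]
  | of_succ j hj ih =>
    have hS : ∑ l ∈ Finset.Ico j (k + 1),
          ((l : ℝ) - j) * ((2 * l + 3) * dblRatio k l) * y ^ (l - j)
        = y * (∑ l ∈ Finset.Ico (j + 1) (k + 1), ((l : ℝ) - (j + 1 : ℕ)) *
            ((2 * l + 3) * dblRatio k l) * y ^ (l - (j + 1))
          + 2 * dblSumWeighted y k (j + 1) + (2 * j + 5) * dblSum y k (j + 1)) := by
      unfold dblSum dblSumWeighted
      rw [Finset.sum_eq_sum_Ico_succ_bot (by omega), sub_self, zero_mul, zero_mul, zero_add,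
        Finset.mul_sum, Finset.mul_sum, ← Finset.sum_add_distrib, ← Finset.sum_add_distrib,
        Finset.mul_sum]
      refine Finset.sum_congr rfl fun l hl => ?_
      rw [pow_sub_eq_mul_pow_sub_succ y (Finset.mem_Ico.1 hl).1]
      push_cast
      ring
    have hrel := dblSum_relation y (k := k) (j := j + 1) hj
    have h1 := dblRatio_succ k j
    rw [hS, ih, dblSum_succ y (k := k) (j := j) (by omega),
      dblSumWeighted_succ y (k := k) (j := j) (by omega), pow_sub_eq_mul_pow_sub_succ y hj]
    push_cast at hrel ⊢
    linear_combination y * hrel - y * h1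

lemma alphaBracket_eq (y : ℝ) {k j : ℕ} (h : j ≤ k + 1) :
    alphaBracket y k j = (2 * k + 3 - y) * (dblSum y k j + dblSumWeighted y k j)
      + (k + 1 - j) * y ^ (k + 1 - j) / (2 * k + 3) := by
  have h2 := sum_shifted_dblRatio y h
  unfold alphaBracket
  rw [← Finset.Ico_add_one_right_eq_Icc]
  have e1 : ∑ l ∈ Finset.Ico j (k + 1),
        ((l : ℝ) + 1 - j) * (((2 * k + 3)‼ : ℝ) / ((2 * l + 3)‼ : ℝ)) * y ^ (l - j)
      = (2 * k + 3) * (dblSum y k j + dblSumWeighted y k j) := by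
    unfold dblSum dblSumWeighted dblRatio
    rw [← Finset.sum_add_distrib, Finset.mul_sum]
    refine Finset.sum_congr rfl fun l _ => ?_
    rw [doubleFactorial_odd_succ k]
    ring
  have e2 : ∑ l ∈ Finset.Ico j (k + 1),
        ((l : ℝ) - j) * (((2 * k + 1)‼ : ℝ) / ((2 * l + 1)‼ : ℝ)) * y ^ (l - j)
      = ∑ l ∈ Finset.Ico j (k + 1), ((l : ℝ) - j) * ((2 * l + 3) * dblRatio k l) * y ^ (l - j) := by
    refine Finset.sum_congr rfl fun l _ => ?_
    have h1 := doubleFactorial_ne_zero (2 * l + 1)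
    unfold dblRatio
    rw [doubleFactorial_odd_succ l]
    field_simp
  rw [e1, e2, h2]
  ring

lemma alphaBracket_recurrence (y : ℝ) {k j : ℕ} (h : j < k) :
    alphaBracket y k j = (y + 2 * j + 5) * alphaBracket y k (j + 1)
      - (2 * j + 3) * (y * alphaBracket y k (j + 2)) := by
  rw [alphaBracket_eq y (by omega), alphaBracket_eq y (by omega), alphaBracket_eq y (by omega),
    pow_sub_eq_mul_pow_sub_succ y (show j + 1 ≤ k + 1 by omega),
    pow_sub_eq_mul_pow_sub_succ y (show j + 1 + 1 ≤ k + 1 by omega)]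
  have hrel := dblSum_relation y (show j + 1 ≤ k + 1 by omega)
  rw [pow_sub_eq_mul_pow_sub_succ y (show j + 1 + 1 ≤ k + 1 by omega)] at hrel
  have h1 := dblRatio_succ k j
  have hV := dblSumWeighted_succ y (show j + 1 ≤ k by omega)
  rw [dblSum_succ y h.le, dblSumWeighted_succ y h.le]
  push_cast at hrel hV ⊢
  linear_combination (2 * (k : ℝ) + 3 - y) * (h1 - hrel - (2 * j + 3) * hV)

lemma alphaBracket_self (y : ℝ) (k : ℕ) : alphaBracket y k k = 1 := by
  simp only [alphaBracket, Finset.Icc_self, Finset.sum_singleton, Nat.sub_self,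
    div_self (doubleFactorial_ne_zero (2 * k + 3))]
  ring

/-- Subtracting the two sums termwise leaves the factor (l+1-j)(2k+3)/(2l+3) - (l-j), nonnegative
because l ≤ k. The term l = j is strictly positive. -/
lemma alphaBracket_pos {y : ℝ} (hy : 0 ≤ y) {k j : ℕ} (h : j ≤ k) : 0 < alphaBracket y k j := by
  unfold alphaBracket
  rw [← Finset.sum_sub_distrib]
  have hterm : ∀ l ∈ Finset.Icc j k,
      (0 : ℝ) ≤ ((l : ℝ) + 1 - j) * (((2 * k + 3)‼ : ℝ) / ((2 * l + 3)‼ : ℝ)) * y ^ (l - j)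
        - ((l : ℝ) - j) * (((2 * k + 1)‼ : ℝ) / ((2 * l + 1)‼ : ℝ)) * y ^ (l - j) := by
    intro l hl
    obtain ⟨h1, h2⟩ := Finset.mem_Icc.1 hl
    have h1' : (j : ℝ) ≤ l := by exact_mod_cast h1
    have h2' : (l : ℝ) ≤ k := by exact_mod_cast h2
    have hk : 0 < (((2 * k + 1)‼ : ℕ) : ℝ) := by exact_mod_cast Nat.doubleFactorial_pos _
    have hl : 0 < (((2 * l + 1)‼ : ℕ) : ℝ) := by exact_mod_cast Nat.doubleFactorial_pos _
    rw [doubleFactorial_odd_succ, doubleFactorial_odd_succ, mul_div_mul_comm, ← sub_mul,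
      ← mul_assoc, ← sub_mul]
    have h3 : 1 ≤ (2 * (k : ℝ) + 3) / (2 * l + 3) := by
      rw [le_div_iff₀ (by positivity)]; linarith
    have h4 : (l : ℝ) - j ≤ (l + 1 - j) * ((2 * (k : ℝ) + 3) / (2 * l + 3)) := by nlinarith
    have h5 := sub_nonneg.2 h4
    positivity
  refine lt_of_lt_of_le ?_ (Finset.single_le_sum hterm (Finset.mem_Icc.2 ⟨le_rfl, h⟩))
  have hk : 0 < (((2 * k + 3)‼ : ℕ) : ℝ) := by exact_mod_cast Nat.doubleFactorial_pos _
  have hl : 0 < (((2 * j + 3)‼ : ℕ) : ℝ) := by exact_mod_cast Nat.doubleFactorial_pos _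
  simp only [Nat.sub_self, pow_zero, sub_self, zero_mul, sub_zero, add_sub_cancel_left, mul_one,
    one_mul]
  positivity

/-- The bracket in the coefficient of `z^{2j}` of `q_{2k+1}`. -/
noncomputable def betaEvenBracket (y : ℝ) (k j : ℕ) : ℝ :=
  (2 * (j : ℝ) + 1) / (2 * (k : ℝ) + 3) * y ^ (k - j)
    + 2 * (dblSum y k j + dblSumWeighted y k j)

/-- The bracket in the coefficient of `z^{2j+1}` of `q_{2k+1}`. -/
noncomputable def betaOddBracket (y : ℝ) (k j : ℕ) : ℝ :=
  (2 * (j : ℝ) + 3) / (2 * (k : ℝ) + 3) * y ^ (k - j) + 2 * dblSumWeighted y k j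

lemma betaEven_eq (a : ℝ) (k j : ℕ) :
    betaEven a k j = a * betaEvenBracket (2 * a ^ 2) k j * coeffRatio a k j := by
  unfold betaEven betaEvenBracket dblSum dblSumWeighted dblRatio
  rw [← Finset.Ico_add_one_right_eq_Icc, ← Finset.sum_add_distrib]
  congr 4
  refine Finset.sum_congr rfl fun l _ => ?_
  ring

lemma betaOdd_eq (a : ℝ) (k j : ℕ) :
    betaOdd a k j = betaOddBracket (2 * a ^ 2) k j * coeffRatio a k j := by
  unfold betaOdd betaOddBracket dblSumWeighted dblRatio
  rw [← Finset.Ico_add_one_right_eq_Icc]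

/-- Again H_j = 2a G_{j+1}, but only below the top index; accordingly orthogonality of q_{2k+1} to
z^m is claimed only for m < 2k. -/
lemma betaOddBracket_eq (y : ℝ) {k j : ℕ} (h : j < k) :
    betaOddBracket y k j = y * betaEvenBracket y k (j + 1) := by
  unfold betaOddBracket betaEvenBracket
  rw [dblSumWeighted_succ y h.le, pow_sub_eq_mul_pow_sub_succ y h]
  push_cast
  ring

lemma betaOddBracket_self (y : ℝ) (k : ℕ) : betaOddBracket y k k = 1 := by
  unfold betaOddBracket
  rw [dblSumWeighted_succ y le_rfl, dblSum_self_succ, dblSumWeighted_self_succ]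
  have : (2 * (k : ℝ) + 3) ≠ 0 := by positivity
  simp [div_self this]

lemma betaEvenBracket_recurrence (y : ℝ) {k j : ℕ} (h : j < k) :
    betaEvenBracket y k j = (y + 2 * j + 5) * betaEvenBracket y k (j + 1)
      - (2 * j + 3) * betaOddBracket y k (j + 1) := by
  unfold betaEvenBracket betaOddBracket
  have hrel := dblSum_relation y (show j + 1 ≤ k + 1 by omega)
  have h1 := dblRatio_succ k j
  rw [Nat.add_sub_add_right, pow_sub_eq_mul_pow_sub_succ y h] at hrel
  rw [dblSum_succ y h.le, dblSumWeighted_succ y h.le, pow_sub_eq_mul_pow_sub_succ y h]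
  push_cast at hrel ⊢
  linear_combination 2 * h1 - 2 * hrel

/-! ### Skew-orthogonal bases for alternating forms -/

/-- `p` is a family of monic real polynomials, one of each degree, that is skew-orthogonal with
positive skew-norms `r` for the form `B`. -/
structure IsSkewBasis (B : ℝ[X] →ₗ[ℝ] ℝ[X] →ₗ[ℝ] ℂ) (p : ℕ → ℝ[X]) (r : ℕ → ℝ) : Prop where
  monic : ∀ n, (p n).Monic
  natDegree_eq : ∀ n, (p n).natDegree = n
  even_even : ∀ k l, B (p (2 * k)) (p (2 * l)) = 0
  odd_odd : ∀ k l, B (p (2 * k + 1)) (p (2 * l + 1)) = 0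
  even_odd : ∀ k l, B (p (2 * k)) (p (2 * l + 1)) = if k = l then (r k : ℂ) else 0
  norm_pos : ∀ k, 0 < r k

lemma eval_map_ofRealHom (f : ℝ[X]) (z : ℂ) : (f.map Complex.ofRealHom).eval z = aeval z f :=
  eval_map_algebraMap f z

lemma aeval_ofReal_eq (f : ℝ[X]) (x : ℝ) : aeval (x : ℂ) f = ((f.eval x : ℝ) : ℂ) :=
  aeval_algebraMap_apply_eq_algebraMap_eval x f

lemma IsSkewBasis.isPlanarSOP {ω : ℂ → ℝ} {hω : SkewIntegrable ω} {p : ℕ → ℝ[X]} {r : ℕ → ℝ}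
    (h : IsSkewBasis (skewForm hω) p r) :
    IsPlanarSOP ω (fun n => (p n).map Complex.ofRealHom) r where
  monic n := (h.monic n).map _
  natDegree_eq n := by rw [(h.monic n).natDegree_map, h.natDegree_eq]
  integrable m n := by
    simp only [eval_map_ofRealHom]
    exact hω _ _
  even_even k l := by
    simp only [eval_map_ofRealHom]
    exact h.even_even k l
  odd_odd k l := by
    simp only [eval_map_ofRealHom]
    exact h.odd_odd k l
  even_odd k l := by
    simp only [eval_map_ofRealHom]
    exact h.even_odd k l
  odd_even k l := by
    simp only [eval_map_ofRealHom]
    rw [← h.even_odd k l, (skewForm_isAlt hω).neg]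
    rfl
  norm_pos := h.norm_pos

section SkewBasis

variable {B : ℝ[X] →ₗ[ℝ] ℝ[X] →ₗ[ℝ] ℂ} {p : ℕ → ℝ[X]} {r : ℕ → ℝ}

lemma form_eq_zero_of_natDegree_lt {f g : ℝ[X]} {n : ℕ} (hf : ∀ m < n, B f (X ^ m) = 0)
    (hg : g.natDegree < n) : B f g = 0 := by
  rw [as_sum_range' g n hg, map_sum]
  refine Finset.sum_eq_zero fun m hm => ?_
  rw [← C_mul_X_pow_eq_monomial, ← smul_eq_C_mul, map_smul, hf m (Finset.mem_range.1 hm), smul_zero]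

lemma form_eq_of_monic {f g : ℝ[X]} {n : ℕ} (hf : ∀ m < n, B f (X ^ m) = 0)
    (hg : g.Monic) (hn : g.natDegree = n) : B f g = B f (X ^ n) := by
  rw [as_sum_range' g (n + 1) (by omega), Finset.sum_range_succ, map_add, map_sum,
    Finset.sum_eq_zero, zero_add, ← hn, coeff_natDegree, hg.leadingCoeff, monomial_one_right_eq_X_pow]
  intro m hm
  rw [← C_mul_X_pow_eq_monomial, ← smul_eq_C_mul, map_smul, hf m (Finset.mem_range.1 hm), smul_zero]

/-- Antisymmetry allows the member of larger degree to be placed on the left, where it annihilates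
lower powers. In the diagonal pairing only the leading power z^{2k+1} of the odd member survives. -/
lemma isSkewBasis_of_monomials (hB : B.IsAlt) (hmonic : ∀ n, (p n).Monic)
    (hdeg : ∀ n, (p n).natDegree = n) (heven : ∀ k, ∀ m < 2 * k + 1, B (p (2 * k)) (X ^ m) = 0)
    (hodd : ∀ k, ∀ m < 2 * k, B (p (2 * k + 1)) (X ^ m) = 0)
    (hnorm : ∀ k, B (p (2 * k)) (X ^ (2 * k + 1)) = (r k : ℂ)) (hr : ∀ k, 0 < r k) :
    IsSkewBasis B p r where
  monic := hmonic
  natDegree_eq := hdeg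
  norm_pos := hr
  even_even k l := by
    rcases le_total l k with h | h
    · exact form_eq_zero_of_natDegree_lt (heven k) (by rw [hdeg]; omega)
    · rw [← hB.neg, form_eq_zero_of_natDegree_lt (heven l) (by rw [hdeg]; omega), neg_zero]
  odd_odd k l := by
    rcases lt_trichotomy l k with h | h | h
    · exact form_eq_zero_of_natDegree_lt (hodd k) (by rw [hdeg]; omega)
    · rw [h]; exact hB _
    · rw [← hB.neg, form_eq_zero_of_natDegree_lt (hodd l) (by rw [hdeg]; omega), neg_zero]
  even_odd k l := by
    rcases lt_trichotomy l k with h | h | h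
    · rw [if_neg h.ne']
      exact form_eq_zero_of_natDegree_lt (heven k) (by rw [hdeg]; omega)
    · subst h
      rw [if_pos rfl, form_eq_of_monic (heven l) (hmonic _) (hdeg _), hnorm]
    · rw [if_neg h.ne, ← hB.neg, form_eq_zero_of_natDegree_lt (hodd l) (by rw [hdeg]; omega),
        neg_zero]

/-! ### The Christoffel transform -/

/-- The skew-kernel `ϰ_N(a, ·)` as a polynomial. -/
noncomputable def kernelSection (p : ℕ → ℝ[X]) (r : ℕ → ℝ) (a : ℝ) (N : ℕ) : ℝ[X] :=
  ∑ j ∈ Finset.range N, (((p (2 * j + 1)).eval a / r j) • p (2 * j)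
    - ((p (2 * j)).eval a / r j) • p (2 * j + 1))

/-- The Christoffel transform of `p` at `a`, multiplied by `X - a`. -/
noncomputable def christoffelNumer (p : ℕ → ℝ[X]) (r : ℕ → ℝ) (a : ℝ) (n : ℕ) : ℝ[X] :=
  if n % 2 = 0 then (-(r (n / 2) / (p n).eval a)) • kernelSection p r a (n / 2 + 1)
  else p (n + 1) - ((p (n + 1)).eval a / (p (n - 1)).eval a) • p (n - 1)

/-- The Christoffel transform of `p` at `a`. -/
noncomputable def christoffel (p : ℕ → ℝ[X]) (r : ℕ → ℝ) (a : ℝ) (n : ℕ) : ℝ[X] :=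
  christoffelNumer p r a n /ₘ (X - C a)

lemma christoffelNumer_even (p : ℕ → ℝ[X]) (r : ℕ → ℝ) (a : ℝ) (k : ℕ) :
    christoffelNumer p r a (2 * k)
      = (-(r k / (p (2 * k)).eval a)) • kernelSection p r a (k + 1) := by
  rw [christoffelNumer, if_pos (by omega), Nat.mul_div_cancel_left k two_pos]

lemma christoffelNumer_odd (p : ℕ → ℝ[X]) (r : ℕ → ℝ) (a : ℝ) (k : ℕ) :
    christoffelNumer p r a (2 * k + 1)
      = p (2 * k + 2) - ((p (2 * k + 2)).eval a / (p (2 * k)).eval a) • p (2 * k) := by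
  rw [christoffelNumer, if_neg (by omega)]
  rfl

lemma eval_kernelSection_self (p : ℕ → ℝ[X]) (r : ℕ → ℝ) (a : ℝ) (N : ℕ) :
    (kernelSection p r a N).eval a = 0 := by
  simp only [kernelSection, eval_finsetSum, eval_sub, eval_smul, smul_eq_mul]
  exact Finset.sum_eq_zero fun j _ => by ring

lemma X_sub_C_mul_christoffel (r : ℕ → ℝ) {a : ℝ} (he : ∀ k, (p (2 * k)).eval a ≠ 0) (n : ℕ) :
    (X - C a) * christoffel p r a n = christoffelNumer p r a n := by
  refine mul_divByMonic_eq_iff_isRoot.2 ?_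
  obtain ⟨k, rfl | rfl⟩ := n.even_or_odd'
  · rw [christoffelNumer_even, IsRoot, eval_smul, eval_kernelSection_self, smul_zero]
  · rw [christoffelNumer_odd, IsRoot, eval_sub, eval_smul, smul_eq_mul, div_mul_cancel₀ _ (he k),
      sub_self]

namespace IsSkewBasis

variable (h : IsSkewBasis B p r)
include h

lemma coeff_self (n : ℕ) : (p n).coeff n = 1 := by
  have := (h.monic n).coeff_natDegree
  rwa [h.natDegree_eq] at this

lemma coeff_of_lt {m n : ℕ} (hmn : n < m) : (p n).coeff m = 0 :=
  coeff_eq_zero_of_natDegree_lt (by rwa [h.natDegree_eq])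

lemma odd_even (hB : B.IsAlt) (k l : ℕ) :
    B (p (2 * k + 1)) (p (2 * l)) = if k = l then -(r k : ℂ) else 0 := by
  rw [← hB.neg, h.even_odd]
  by_cases hkl : k = l
  · rw [if_pos hkl.symm, if_pos hkl, hkl]
  · rw [if_neg (Ne.symm hkl), if_neg hkl, neg_zero]

/-- The reproducing property: only the summand j = m pairs nontrivially, and its factor r_m cancels.
-/
lemma form_kernelSection_even (hB : B.IsAlt) (a : ℝ) (N m : ℕ) :
    B (kernelSection p r a N) (p (2 * m)) = if m < N then (((p (2 * m)).eval a : ℝ) : ℂ) else 0 := by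
  have hr : (r m : ℂ) ≠ 0 := by exact_mod_cast (h.norm_pos m).ne'
  simp only [kernelSection, map_sum, LinearMap.sum_apply, map_sub, map_smul, LinearMap.sub_apply,
    LinearMap.smul_apply, h.even_even, h.odd_even hB, smul_zero, zero_sub, Complex.real_smul,
    mul_ite, mul_zero, Finset.sum_neg_distrib, Finset.sum_ite_eq', Finset.mem_range]
  split_ifs with hm
  · push_cast
    field_simp
  · simp

lemma form_kernelSection_odd (a : ℝ) (N m : ℕ) :
    B (kernelSection p r a N) (p (2 * m + 1))
      = if m < N then (((p (2 * m + 1)).eval a : ℝ) : ℂ) else 0 := by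
  have hr : (r m : ℂ) ≠ 0 := by exact_mod_cast (h.norm_pos m).ne'
  simp only [kernelSection, map_sum, LinearMap.sum_apply, map_sub, map_smul, LinearMap.sub_apply,
    LinearMap.smul_apply, h.odd_odd, h.even_odd, smul_zero, sub_zero, Complex.real_smul,
    mul_ite, mul_zero, Finset.sum_ite_eq', Finset.mem_range]
  split_ifs with hm
  · push_cast
    field_simp
  · rfl

/-- Reproducing the second section at a makes each of its summands an antisymmetric expression
evaluated at (a, a). -/
lemma form_kernelSection_kernelSection (hB : B.IsAlt) (a : ℝ) (N M : ℕ) :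
    B (kernelSection p r a N) (kernelSection p r a M) = 0 := by
  rw [kernelSection.eq_1 p r a M]
  simp only [map_sum, map_sub, map_smul, h.form_kernelSection_even hB, h.form_kernelSection_odd]
  refine Finset.sum_eq_zero fun j _ => ?_
  split_ifs
  · simp only [Complex.real_smul]
    push_cast
    ring
  · simp

lemma monic_christoffelNumer {a : ℝ} (he : ∀ k, (p (2 * k)).eval a ≠ 0) (n : ℕ) :
    (christoffelNumer p r a n).Monic ∧ (christoffelNumer p r a n).natDegree = n + 1 := by
  suffices H : (∀ m, n + 1 < m → (christoffelNumer p r a n).coeff m = 0) ∧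
      (christoffelNumer p r a n).coeff (n + 1) = 1 by
    have hle : (christoffelNumer p r a n).natDegree ≤ n + 1 :=
      natDegree_le_iff_coeff_eq_zero.2 H.1
    exact ⟨monic_of_natDegree_le_of_coeff_eq_one _ hle H.2,
      natDegree_eq_of_le_of_coeff_ne_zero hle (by rw [H.2]; exact one_ne_zero)⟩
  obtain ⟨k, rfl | rfl⟩ := n.even_or_odd'
  · rw [christoffelNumer_even]
    simp only [kernelSection, coeff_smul, finsetSum_coeff, coeff_sub, smul_eq_mul]
    constructor
    · intro m hm
      rw [Finset.sum_eq_zero, mul_zero]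
      intro j hj
      have := Finset.mem_range.1 hj
      rw [h.coeff_of_lt (by omega), h.coeff_of_lt (by omega)]
      simp
    · rw [Finset.sum_range_succ, Finset.sum_eq_zero, h.coeff_self, h.coeff_of_lt (by omega)]
      · have h1 := he k
        have h2 := (h.norm_pos k).ne'
        field_simp
        ring
      · intro j hj
        have := Finset.mem_range.1 hj
        rw [h.coeff_of_lt (by omega), h.coeff_of_lt (by omega)]
        simp
  · rw [christoffelNumer_odd]
    simp only [coeff_smul, coeff_sub, smul_eq_mul]
    constructor
    · intro m hm
      rw [h.coeff_of_lt (by omega), h.coeff_of_lt (by omega)]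
      simp
    · rw [h.coeff_self, h.coeff_of_lt (by omega)]
      simp

/-- The Christoffel transform is skew-orthogonal for the form `B ((X - a) f) ((X - a) g)`. -/
theorem christoffel (hB : B.IsAlt) {a : ℝ} (he : ∀ k, 0 < (p (2 * k)).eval a)
    {B' : ℝ[X] →ₗ[ℝ] ℝ[X] →ₗ[ℝ] ℂ}
    (hB' : ∀ f g, B' f g = B ((X - C a) * f) ((X - C a) * g)) :
    IsSkewBasis B' (christoffel p r a)
      (fun k => r k * ((p (2 * k + 2)).eval a / (p (2 * k)).eval a)) := by
  have he' : ∀ k, (p (2 * k)).eval a ≠ 0 := fun k => (he k).ne'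
  have hmul := X_sub_C_mul_christoffel r he'
  have hmonic : ∀ n, (_root_.christoffel p r a n).Monic := fun n =>
    (monic_X_sub_C a).of_mul_monic_left (by rw [hmul]; exact (h.monic_christoffelNumer he' n).1)
  refine ⟨hmonic, fun n => ?_, fun k l => ?_, fun k l => ?_, fun k l => ?_, fun k => ?_⟩
  · have h1 := (h.monic_christoffelNumer he' n).2
    rw [← hmul, (monic_X_sub_C a).natDegree_mul (hmonic n), natDegree_X_sub_C] at h1
    omega
  · rw [hB', hmul, hmul, christoffelNumer_even, christoffelNumer_even]
    simp only [map_smul, LinearMap.smul_apply, h.form_kernelSection_kernelSection hB, smul_zero]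
  -- Odd numerators involve only even-indexed members, which pair to zero.
  · rw [hB', hmul, hmul, christoffelNumer_odd, christoffelNumer_odd,
      show 2 * k + 2 = 2 * (k + 1) by ring, show 2 * l + 2 = 2 * (l + 1) by ring]
    simp only [map_sub, map_smul, LinearMap.sub_apply, LinearMap.smul_apply, h.even_even,
      smul_zero, sub_zero]
  · rw [hB', hmul, hmul, christoffelNumer_even, christoffelNumer_odd,
      show 2 * l + 2 = 2 * (l + 1) by ring]
    simp only [map_sub, map_smul, LinearMap.smul_apply, h.form_kernelSection_even hB]
    have hl : (((p (2 * l)).eval a : ℝ) : ℂ) ≠ 0 := by exact_mod_cast he' l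
    -- For l < k both values at a are reproduced and cancel by the choice of ratio; for l = k only
    -- that of p_{2k} is, which leaves the norm; for l > k neither is.
    rcases lt_trichotomy l k with hkl | rfl | hkl
    · rw [if_pos (by omega), if_pos (by omega), if_neg hkl.ne']
      simp only [Complex.real_smul]
      push_cast
      field_simp
      ring
    · rw [if_neg (by omega), if_pos (by omega), if_pos rfl,
        show 2 * l + 2 = 2 * (l + 1) by ring]
      simp only [Complex.real_smul]
      push_cast
      field_simp
      ring
    · rw [if_neg (by omega), if_neg (by omega), if_neg hkl.ne]
      simp
  · exact mul_pos (h.norm_pos k) (div_pos (he (k + 1)) (he k))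

end IsSkewBasis

end SkewBasis

/-- The skew-kernel of the Christoffel transform, multiplied by `(z - a) (w - a)`: the identity
behind it, for the values `e`, `o` of the even and odd polynomials at `z`, `w` and `a`. -/
lemma sum_christoffel_values {K : Type*} [Field K] {r ea oa ez oz ew ow : ℕ → K}
    (hr : ∀ k, r k ≠ 0) (he : ∀ k, ea k ≠ 0) {κzw κza κwa : ℕ → K}
    (hzw : ∀ N, κzw N = ∑ k ∈ Finset.range N, (oz k * ew k - ez k * ow k) / r k)
    (hza : ∀ N, κza N = ∑ k ∈ Finset.range N, (oz k * ea k - ez k * oa k) / r k)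
    (hwa : ∀ N, κwa N = ∑ k ∈ Finset.range N, (ow k * ea k - ew k * oa k) / r k) (N : ℕ) :
    (∑ k ∈ Finset.range N,
      ((ez (k + 1) - ea (k + 1) / ea k * ez k) * (r k / ea k * κwa (k + 1))
        - (r k / ea k * κza (k + 1)) * (ew (k + 1) - ea (k + 1) / ea k * ew k))
          / (r k * (ea (k + 1) / ea k))
      = (κzw N * ea N - κza N * ew N + κwa N * ez N) / ea N) ∧
    κzw (N + 1) * ea N - κza (N + 1) * ew N + κwa (N + 1) * ez N
      = κzw N * ea N - κza N * ew N + κwa N * ez N := by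
  -- The extra summand k = N contributes the expansion of a 3 × 3 determinant with rows e, e, o,
  -- which is zero. Hence M = N and M = N + 1 give the same numerator.
  have hstep : ∀ N, κzw (N + 1) * ea N - κza (N + 1) * ew N + κwa (N + 1) * ez N
      = κzw N * ea N - κza N * ew N + κwa N * ez N := by
    intro N
    have := hr N
    rw [hzw, hza, hwa, hzw, hza, hwa, Finset.sum_range_succ, Finset.sum_range_succ,
      Finset.sum_range_succ]
    field_simp
    ring
  refine ⟨?_, hstep N⟩
  induction N with
  | zero => simp [hzw, hza, hwa]
  | succ N ih =>
    -- The form with M = N + 1 puts all kernels at the index that occurs in the new summand.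
    rw [Finset.sum_range_succ, ih, ← hstep N]
    have h1 := hr N
    have h2 := he N
    have h3 := he (N + 1)
    field_simp
    ring

/-! ### The explicit polynomials of the pre-overlap weight -/

lemma coeff_even_of_parts (u v : ℕ → ℝ) (n m i : ℕ) :
    (∑ j ∈ Finset.range n, C (u j) * X ^ (2 * j)
      + ∑ j ∈ Finset.range m, C (v j) * X ^ (2 * j + 1)).coeff (2 * i)
      = if i < n then u i else 0 := by
  have h1 : ∀ j, (2 * i = 2 * j) = (i = j) := fun j => propext (by omega)
  have h2 : ∀ j, (2 * i = 2 * j + 1) = False := fun j => eq_false (by omega)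
  simp [finsetSum_coeff, coeff_X_pow, h1, h2]

lemma coeff_odd_of_parts (u v : ℕ → ℝ) (n m i : ℕ) :
    (∑ j ∈ Finset.range n, C (u j) * X ^ (2 * j)
      + ∑ j ∈ Finset.range m, C (v j) * X ^ (2 * j + 1)).coeff (2 * i + 1)
      = if i < m then v i else 0 := by
  have h1 : ∀ j, (2 * i + 1 = 2 * j) = False := fun j => eq_false (by omega)
  simp [finsetSum_coeff, coeff_X_pow, h1]

/-- No bound on i is needed, since the bracket is an empty sum beyond the top index; the
orthogonality relations do look past the top. -/
lemma preEven_coeff_even (a : ℝ) (k i : ℕ) :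
    (preEven a k).coeff (2 * i) = alphaBracket (2 * a ^ 2) k i * coeffRatio a k i := by
  rw [preEven, coeff_even_of_parts, alphaEven_eq]
  split_ifs with h
  · rfl
  · simp [alphaBracket, Finset.Icc_eq_empty (show ¬ i ≤ k by omega)]

lemma preEven_coeff_odd (a : ℝ) (k i : ℕ) :
    (preEven a k).coeff (2 * i + 1)
      = 2 * a * alphaBracket (2 * a ^ 2) k (i + 1) * coeffRatio a k i := by
  rw [preEven, coeff_odd_of_parts, alphaOdd_eq]
  split_ifs with h
  · rfl
  · simp [alphaBracket, Finset.Icc_eq_empty (show ¬ i + 1 ≤ k by omega)]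

lemma preOdd_coeff_even (a : ℝ) {k i : ℕ} (h : i ≤ k) :
    (preOdd a k).coeff (2 * i) = a * betaEvenBracket (2 * a ^ 2) k i * coeffRatio a k i := by
  rw [preOdd, coeff_even_of_parts, if_pos (by omega), betaEven_eq]

lemma preOdd_coeff_odd (a : ℝ) {k i : ℕ} (h : i ≤ k) :
    (preOdd a k).coeff (2 * i + 1) = betaOddBracket (2 * a ^ 2) k i * coeffRatio a k i := by
  rw [preOdd, coeff_odd_of_parts, if_pos (by omega), betaOdd_eq]

lemma monic_preEven (a : ℝ) (k : ℕ) :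
    (preEven a k).Monic ∧ (preEven a k).natDegree = 2 * k := by
  have hle : (preEven a k).natDegree ≤ 2 * k := by
    refine natDegree_le_iff_coeff_eq_zero.2 fun m hm => ?_
    obtain ⟨i, rfl | rfl⟩ := m.even_or_odd'
    · rw [preEven, coeff_even_of_parts, if_neg (by omega)]
    · rw [preEven, coeff_odd_of_parts, if_neg (by omega)]
  have h1 : (preEven a k).coeff (2 * k) = 1 := by
    rw [preEven_coeff_even, alphaBracket_self, coeffRatio_self, one_mul]
  exact ⟨monic_of_natDegree_le_of_coeff_eq_one _ hle h1,
    natDegree_eq_of_le_of_coeff_ne_zero hle (by rw [h1]; exact one_ne_zero)⟩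

lemma monic_preOdd (a : ℝ) (k : ℕ) :
    (preOdd a k).Monic ∧ (preOdd a k).natDegree = 2 * k + 1 := by
  have hle : (preOdd a k).natDegree ≤ 2 * k + 1 := by
    refine natDegree_le_iff_coeff_eq_zero.2 fun m hm => ?_
    obtain ⟨i, rfl | rfl⟩ := m.even_or_odd'
    · rw [preOdd, coeff_even_of_parts, if_neg (by omega)]
    · rw [preOdd, coeff_odd_of_parts, if_neg (by omega)]
  have h1 : (preOdd a k).coeff (2 * k + 1) = 1 := by
    rw [preOdd_coeff_odd a le_rfl, betaOddBracket_self, coeffRatio_self, one_mul]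
  exact ⟨monic_of_natDegree_le_of_coeff_eq_one _ hle h1,
    natDegree_eq_of_le_of_coeff_ne_zero hle (by rw [h1]; exact one_ne_zero)⟩

lemma preForm_preEven_X_pow (a : ℝ) {k m : ℕ} (h : m < 2 * k + 1) :
    preForm a (preEven a k) (X ^ m) = 0 := by
  have hrec : ∀ j < k, alphaBracket (2 * a ^ 2) k j
      = (2 * a ^ 2 + 2 * j + 5) * alphaBracket (2 * a ^ 2) k (j + 1)
        - (2 * j + 3) * a * (2 * a * alphaBracket (2 * a ^ 2) k (j + 1 + 1)) := fun j hj => by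
    linear_combination alphaBracket_recurrence (2 * a ^ 2) hj
  obtain ⟨i, rfl | rfl⟩ := m.even_or_odd'
  · exact preForm_X_pow_even_eq_zero (k := k) (G := alphaBracket (2 * a ^ 2) k)
      (H := fun j => 2 * a * alphaBracket (2 * a ^ 2) k (j + 1))
      (fun j _ => preEven_coeff_even a k j) (fun j _ => preEven_coeff_odd a k j)
      (fun _ _ => rfl) (fun j hj => hrec j (by omega))
  · exact preForm_X_pow_odd_eq_zero (k := k) (G := alphaBracket (2 * a ^ 2) k)
      (H := fun j => 2 * a * alphaBracket (2 * a ^ 2) k (j + 1))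
      (fun j _ => preEven_coeff_even a k j) (fun j _ => preEven_coeff_odd a k j)
      (fun _ _ => rfl) (hrec i (by omega))

lemma preForm_preOdd_X_pow (a : ℝ) {k m : ℕ} (h : m < 2 * k) :
    preForm a (preOdd a k) (X ^ m) = 0 := by
  have hH : ∀ j < k, betaOddBracket (2 * a ^ 2) k j
      = 2 * a * (a * betaEvenBracket (2 * a ^ 2) k (j + 1)) := fun j hj => by
    rw [betaOddBracket_eq _ hj]
    ring
  have hrec : ∀ j < k, a * betaEvenBracket (2 * a ^ 2) k j
      = (2 * a ^ 2 + 2 * j + 5) * (a * betaEvenBracket (2 * a ^ 2) k (j + 1))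
        - (2 * j + 3) * a * betaOddBracket (2 * a ^ 2) k (j + 1) := fun j hj => by
    linear_combination a * betaEvenBracket_recurrence (2 * a ^ 2) hj
  obtain ⟨i, rfl | rfl⟩ := m.even_or_odd'
  · exact preForm_X_pow_even_eq_zero (k := k) (G := fun j => a * betaEvenBracket (2 * a ^ 2) k j)
      (H := betaOddBracket (2 * a ^ 2) k)
      (fun j _ => preOdd_coeff_even a (by omega)) (fun j _ => preOdd_coeff_odd a (by omega))
      (fun j _ => hH j (by omega)) (fun j hj => hrec j (by omega))
  · exact preForm_X_pow_odd_eq_zero (k := k) (G := fun j => a * betaEvenBracket (2 * a ^ 2) k j)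
      (H := betaOddBracket (2 * a ^ 2) k)
      (fun j _ => preOdd_coeff_even a (by omega)) (fun j _ => preOdd_coeff_odd a (by omega))
      (fun j _ => hH j (by omega)) (hrec i (by omega))

lemma rPre_pos (a : ℝ) (k : ℕ) : 0 < rPre a k := by
  have := fSum_pos k (sq_nonneg a)
  have := fSum_pos (k + 1) (sq_nonneg a)
  unfold rPre
  positivity

lemma rPre_eq (a : ℝ) (k : ℕ) :
    rPre a k = 2 * gaussMoment (2 * k + 1) * ((k + 1) * (fSum (k + 1) (a ^ 2) / fSum k (a ^ 2))) := by
  unfold rPre gaussMoment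
  rw [show 2 * k + 2 = 2 * k + 1 + 1 by ring, Nat.factorial_succ]
  push_cast
  ring

/-- Only the coefficients of z^{2k} and z^{2k-1} contribute. For k > 0 they give a² + k + 2 - a²
f_{k-1}/f_k, which is (k + 1) f_{k+1}/f_k by the recurrence of f. -/
lemma preForm_preEven_X_pow_succ (a : ℝ) (k : ℕ) :
    preForm a (preEven a k) (X ^ (2 * k + 1)) = (rPre a k : ℂ) := by
  rw [preForm_right_X_pow, rPre_eq]
  congr 2
  have hf := fSum_pos k (sq_nonneg a)
  have hdeg : ∀ n, 2 * k < n → (preEven a k).coeff n = 0 := fun n hn =>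
    coeff_eq_zero_of_natDegree_lt (by rwa [(monic_preEven a k).2])
  have e1 : (X ^ 2 * preEven a k).coeff (2 * k + 1 + 1) = 1 := by
    rw [show 2 * k + 1 + 1 = 2 * k + 2 by ring, coeff_X_sq_mul, preEven_coeff_even,
      alphaBracket_self, coeffRatio_self, one_mul]
  have e3 : (X ^ 2 * preEven a k).coeff (2 * k + 1 + 3) = 0 := by
    rw [show 2 * k + 1 + 3 = 2 * k + 2 + 2 by ring, coeff_X_sq_mul, hdeg _ (by omega)]
  have e4 : (X ^ 2 * preEven a k).coeff (2 * k + 1 + 4) = 0 := by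
    rw [show 2 * k + 1 + 4 = 2 * k + 3 + 2 by ring, coeff_X_sq_mul, hdeg _ (by omega)]
  rw [e1, e3, e4]
  cases k with
  | zero =>
    rw [coeff_X_sq_mul_of_lt _ (by norm_num), fSum_one, fSum_zero]
    push_cast
    ring
  | succ k =>
    have e0 : (X ^ 2 * preEven a (k + 1)).coeff (2 * (k + 1) + 1)
        = 2 * a * (fSum k (a ^ 2) / (2 * fSum (k + 1) (a ^ 2))) := by
      rw [show 2 * (k + 1) + 1 = (2 * k + 1) + 2 by ring, coeff_X_sq_mul, preEven_coeff_odd,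
        alphaBracket_self, coeffRatio, pow_succ]
      field_simp
      ring
    have hr := fSum_recurrence k (a ^ 2)
    rw [e0]
    push_cast
    field_simp
    linear_combination -16 * hr

lemma qPreReal_even (a : ℝ) (k : ℕ) : qPreReal a (2 * k) = preEven a k := by
  rw [qPreReal, if_pos (by omega), Nat.mul_div_cancel_left k two_pos]

lemma qPreReal_odd (a : ℝ) (k : ℕ) : qPreReal a (2 * k + 1) = preOdd a k := by
  rw [qPreReal, if_neg (by omega), show (2 * k + 1) / 2 = k by omega]

/-- The explicit polynomials are skew-orthogonal for the pre-overlap weight. -/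
theorem isSkewBasis_qPreReal (a : ℝ) : IsSkewBasis (preForm a) (qPreReal a) (rPre a) := by
  refine isSkewBasis_of_monomials (skewForm_isAlt _) (fun n => ?_) (fun n => ?_)
    (fun k m hm => ?_) (fun k m hm => ?_) (fun k => ?_) (rPre_pos a)
  · obtain ⟨k, rfl | rfl⟩ := n.even_or_odd'
    · rw [qPreReal_even]; exact (monic_preEven a k).1
    · rw [qPreReal_odd]; exact (monic_preOdd a k).1
  · obtain ⟨k, rfl | rfl⟩ := n.even_or_odd'
    · rw [qPreReal_even]; exact (monic_preEven a k).2
    · rw [qPreReal_odd]; exact (monic_preOdd a k).2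
  · rw [qPreReal_even]; exact preForm_preEven_X_pow a hm
  · rw [qPreReal_odd]; exact preForm_preOdd_X_pow a hm
  · rw [qPreReal_even]; exact preForm_preEven_X_pow_succ a k

/-- Odd coefficients carry a factor a, so at z = a only even powers of a appear, with nonnegative
coefficients; the constant term is positive. -/
lemma eval_qPreReal_even_pos (a : ℝ) (k : ℕ) : 0 < (qPreReal a (2 * k)).eval a := by
  have hy : (0 : ℝ) ≤ 2 * a ^ 2 := by positivity
  simp only [qPreReal_even, preEven, eval_add, eval_finsetSum, eval_mul, eval_C, eval_pow, eval_X,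
    alphaEven_eq, alphaOdd_eq]
  have h1 : ∀ j ∈ Finset.range (k + 1),
      0 ≤ alphaBracket (2 * a ^ 2) k j * coeffRatio a k j * a ^ (2 * j) := fun j hj => by
    have := alphaBracket_pos hy (show j ≤ k from Nat.lt_succ_iff.1 (Finset.mem_range.1 hj))
    have := coeffRatio_pos a k j
    rw [pow_mul]
    positivity
  refine add_pos_of_pos_of_nonneg ?_ (Finset.sum_nonneg fun j hj => ?_)
  · refine lt_of_lt_of_le ?_ (Finset.single_le_sum h1 (Finset.mem_range.2 k.succ_pos))
    have := alphaBracket_pos hy k.zero_le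
    have := coeffRatio_pos a k 0
    simp only [mul_zero, pow_zero, mul_one]
    positivity
  · have := alphaBracket_pos hy (show j + 1 ≤ k from Finset.mem_range.1 hj)
    have := coeffRatio_pos a k j
    rw [show 2 * a * alphaBracket (2 * a ^ 2) k (j + 1) * coeffRatio a k j * a ^ (2 * j + 1)
      = 2 * alphaBracket (2 * a ^ 2) k (j + 1) * coeffRatio a k j * (a ^ 2) ^ (j + 1) by ring]
    positivity

/-! ### The overlap weight -/

lemma skewIntegrand_overWeight (a : ℝ) (f g : ℝ[X]) (z : ℂ) :
    skewIntegrand (overWeight a) (fun z => aeval z f) (fun z => aeval z g) z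
      = skewIntegrand (preWeight a) (fun z => aeval z ((X - C a) * f))
          (fun z => aeval z ((X - C a) * g)) z := by
  have h : ((‖z - a‖ ^ 2 : ℝ) : ℂ) = (z - a) * (conj z - a) := by
    rw [← Complex.normSq_eq_norm_sq, ← Complex.mul_conj, map_sub, Complex.conj_ofReal]
  have hw : (overWeight a z : ℂ) = (z - a) * (conj z - a) * (preWeight a z : ℂ) := by
    rw [overWeight, Complex.conj_ofReal, mul_assoc, ← preWeight, Complex.ofReal_mul, h]
  simp only [skewIntegrand, hw, map_mul, map_sub, aeval_X, aeval_C, Complex.coe_algebraMap,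
    Complex.conj_ofReal]
  ring

lemma skewIntegrable_overWeight (a : ℝ) : SkewIntegrable (overWeight a) := fun f g =>
  (skewIntegrable_preWeight a _ _).congr
    (Filter.Eventually.of_forall fun z => (skewIntegrand_overWeight a f g z).symm)

/-- The Christoffel transforms at `a` of the explicit polynomials. -/
noncomputable def qOverReal (a : ℝ) (n : ℕ) : ℝ[X] := christoffel (qPreReal a) (rPre a) a n

theorem isSkewBasis_qOverReal (a : ℝ) :
    IsSkewBasis (skewForm (skewIntegrable_overWeight a)) (qOverReal a) (rOver a) :=
  (isSkewBasis_qPreReal a).christoffel (skewForm_isAlt _) (eval_qPreReal_even_pos a) fun f g =>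
    integral_congr_ae (Filter.Eventually.of_forall (skewIntegrand_overWeight a f g))

lemma sub_mul_eval_qOver (a : ℝ) (n : ℕ) (z : ℂ) :
    (z - a) * aeval z (qOverReal a n) = aeval z (christoffelNumer (qPreReal a) (rPre a) a n) := by
  rw [← X_sub_C_mul_christoffel (rPre a) fun k => (eval_qPreReal_even_pos a k).ne']
  simp [qOverReal]

lemma aeval_kernelSection (a : ℝ) (N : ℕ) (z : ℂ) :
    aeval z (kernelSection (qPreReal a) (rPre a) a N) = kernelPre a N a z := by
  simp only [kernelSection, kernelPre, skewKernel, qPre, eval_map_ofRealHom, aeval_ofReal_eq,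
    map_sum, map_sub, map_smul, Complex.real_smul]
  refine Finset.sum_congr rfl fun j _ => ?_
  push_cast
  ring

lemma skewKernel_swap (q : ℕ → ℂ[X]) (r : ℕ → ℝ) (N : ℕ) (z w : ℂ) :
    skewKernel q r N z w = -skewKernel q r N w z := by
  unfold skewKernel
  rw [← Finset.sum_neg_distrib]
  exact Finset.sum_congr rfl fun k _ => by ring

lemma sub_mul_eval_qOver_even (a : ℝ) (k : ℕ) (z : ℂ) :
    (z - a) * aeval z (qOverReal a (2 * k))
      = (rPre a k : ℂ) / (qPre a (2 * k)).eval (a : ℂ) * kernelPre a (k + 1) z a := by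
  rw [sub_mul_eval_qOver, christoffelNumer_even, map_smul, aeval_kernelSection, kernelPre,
    skewKernel_swap, Complex.real_smul, qPre, eval_map_ofRealHom, aeval_ofReal_eq, kernelPre]
  push_cast
  ring

lemma sub_mul_eval_qOver_odd (a : ℝ) (k : ℕ) (z : ℂ) :
    (z - a) * aeval z (qOverReal a (2 * k + 1))
      = (qPre a (2 * (k + 1))).eval z - (qPre a (2 * (k + 1))).eval (a : ℂ)
        / (qPre a (2 * k)).eval (a : ℂ) * (qPre a (2 * k)).eval z := by
  rw [sub_mul_eval_qOver, christoffelNumer_odd, show 2 * k + 2 = 2 * (k + 1) by ring]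
  simp only [qPre, eval_map_ofRealHom, aeval_ofReal_eq, map_sub, map_smul, Complex.real_smul]
  push_cast
  rfl

theorem proposition2p4 (a : ℝ) :
    (∀ k : ℕ, (qPre a (2 * k)).eval (a : ℂ) ≠ 0) ∧
    ∃ qOver : ℕ → ℂ[X],
      (∀ (k : ℕ) (z : ℂ), z ≠ (a : ℂ) →
        (qOver (2 * k)).eval z
          = (rPre a k : ℂ) * kernelPre a (k + 1) (a : ℂ) z
            / (((a : ℂ) - z) * (qPre a (2 * k)).eval (a : ℂ))) ∧
      (∀ (k : ℕ) (z : ℂ), z ≠ (a : ℂ) →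
        (qOver (2 * k + 1)).eval z
          = ((qPre a (2 * k + 2)).eval (a : ℂ) * (qPre a (2 * k)).eval z
              - (qPre a (2 * k)).eval (a : ℂ) * (qPre a (2 * k + 2)).eval z)
            / (((a : ℂ) - z) * (qPre a (2 * k)).eval (a : ℂ))) ∧
      IsPlanarSOP (overWeight (a : ℂ)) qOver (rOver a) ∧
      (∀ (N : ℕ) (z w : ℂ), z ≠ (a : ℂ) → w ≠ (a : ℂ) →
        skewKernel qOver (rOver a) N z w
          = (kernelPre a N z w * (qPre a (2 * N)).eval (a : ℂ)
              - kernelPre a N z (a : ℂ) * (qPre a (2 * N)).eval w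
              + kernelPre a N w (a : ℂ) * (qPre a (2 * N)).eval z)
            / ((z - a) * (w - a) * (qPre a (2 * N)).eval (a : ℂ))) ∧
      (∀ (N : ℕ) (z w : ℂ), z ≠ (a : ℂ) → w ≠ (a : ℂ) →
        skewKernel qOver (rOver a) N z w
          = (kernelPre a (N + 1) z w * (qPre a (2 * N)).eval (a : ℂ)
              - kernelPre a (N + 1) z (a : ℂ) * (qPre a (2 * N)).eval w
              + kernelPre a (N + 1) w (a : ℂ) * (qPre a (2 * N)).eval z)
            / ((z - a) * (w - a) * (qPre a (2 * N)).eval (a : ℂ))) := by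
  have he : ∀ k : ℕ, (qPre a (2 * k)).eval (a : ℂ) ≠ 0 := fun k => by
    rw [qPre, eval_map_ofRealHom, aeval_ofReal_eq]
    exact_mod_cast (eval_qPreReal_even_pos a k).ne'
  have hr : ∀ k, (rPre a k : ℂ) ≠ 0 := fun k => by exact_mod_cast (rPre_pos a k).ne'
  have hvalues := fun z w => sum_christoffel_values (r := fun k => (rPre a k : ℂ)) hr
    (ea := fun k => (qPre a (2 * k)).eval (a : ℂ)) he
    (κzw := fun N => kernelPre a N z w) (κza := fun N => kernelPre a N z a)
    (κwa := fun N => kernelPre a N w a) (fun _ => rfl) (fun _ => rfl) (fun _ => rfl)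
  have hkernel : ∀ (N : ℕ) (z w : ℂ), z ≠ (a : ℂ) → w ≠ (a : ℂ) →
      skewKernel (fun n => (qOverReal a n).map Complex.ofRealHom) (rOver a) N z w
        = (kernelPre a N z w * (qPre a (2 * N)).eval (a : ℂ)
            - kernelPre a N z (a : ℂ) * (qPre a (2 * N)).eval w
            + kernelPre a N w (a : ℂ) * (qPre a (2 * N)).eval z)
          / ((z - a) * (w - a) * (qPre a (2 * N)).eval (a : ℂ)) := by
    intro N z w hz hw
    have hz' : z - a ≠ 0 := sub_ne_zero.2 hz
    have hw' : w - a ≠ 0 := sub_ne_zero.2 hw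
    rw [mul_comm ((z - a) * (w - a)), ← div_div, ← (hvalues z w N).1,
      eq_div_iff (mul_ne_zero hz' hw'), skewKernel, Finset.sum_mul]
    refine Finset.sum_congr rfl fun k _ => ?_
    have hro : (rOver a k : ℂ) = rPre a k *
        ((qPre a (2 * (k + 1))).eval (a : ℂ) / (qPre a (2 * k)).eval (a : ℂ)) := by
      simp only [rOver, qPre, eval_map_ofRealHom, aeval_ofReal_eq]
      push_cast
      rfl
    rw [← hro, ← sub_mul_eval_qOver_even, ← sub_mul_eval_qOver_even, ← sub_mul_eval_qOver_odd,
      ← sub_mul_eval_qOver_odd]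
    simp only [eval_map_ofRealHom]
    ring
  refine ⟨he, fun n => (qOverReal a n).map Complex.ofRealHom, fun k z hz => ?_, fun k z hz => ?_,
    (isSkewBasis_qOverReal a).isPlanarSOP, hkernel, fun N z w hz hw => ?_⟩
  · have hz' : (a : ℂ) - z ≠ 0 := sub_ne_zero.2 hz.symm
    have h := sub_mul_eval_qOver_even a k z
    rw [kernelPre, skewKernel_swap, ← kernelPre] at h
    have h1 := he k
    rw [eval_map_ofRealHom, eq_div_iff (mul_ne_zero hz' h1)]
    field_simp at h
    linear_combination -h
  · have hz' : (a : ℂ) - z ≠ 0 := sub_ne_zero.2 hz.symm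
    have h := sub_mul_eval_qOver_odd a k z
    have h1 := he k
    rw [show 2 * (k + 1) = 2 * k + 2 by ring] at h
    rw [eval_map_ofRealHom, eq_div_iff (mul_ne_zero hz' h1)]
    field_simp at h
    linear_combination -h
  · rw [hkernel N z w hz hw, (hvalues z w N).2]
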